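/- **Setting.** Let $\mathcal H$ be a complex Hilbert space and $\rho$ a state on $\mathcal H$ (a positive operator of trace one). Let $|\Psi\rangle=\sum_i\sqrt{\lambda_i}\,|\alpha_i\rangle\otimes\langle\alpha_i|\in\mathcal H\otimes\mathcal H^*$ be its canonical purification, for a spectral decomposition $\rho=\sum_i\lambda_i|\alpha_i\rangle\langle\alpha_i|$ with $(\alpha_i)$ orthonormal and $\lambda_i\ge 0$. Let $A_1,\dots,A_n$ be bounded self-adjoint operators on $\mathcal H$, let $N\ge 1$ be an integer, and let $w:S_n\to\mathbb C$ satisfy $\sum_{\sigma\in S_n}w(\sigma)=1$. For $\theta\in\mathbb R^n$ put $$\tilde f^{(N,w)}_{A}(\theta)=\Big[\sum_{\sigma\in S_n}w(\sigma)\,e^{\frac{i\theta_{\sigma(1)}}{N}A_{\sigma(1)}}\cdots e^{\frac{i\theta_{\sigma(n)}}{N}A_{\sigma(n)}}\Big]^N,\qquad C_A(\theta,\rho)=\langle\Psi|\,\tilde f^{(N,w)}_A(\theta)\otimes 1\,|\Psi\rangle .$$ For a compactly supported distribution $u$ and a smooth function $g$, $\int u(x)g(x)\,d^nx$ denotes the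 pairing $\langle u,g\rangle$. **Theorem (Extended Bochner's theorem).** The function $C_A(\cdot,\rho)$ is bounded and smooth, and there is a unique compactly supported distribution $\mathrm{Pr}_A(x,\rho)\in\mathcal E'(\mathbb R^n)\subset\mathcal S'(\mathbb R^n)$ whose Fourier transform is $C_A(\cdot,\rho)$: $$C_A(\theta,\rho)=\int_{\mathbb R^n}\mathrm{Pr}_A(x,\rho)\,e^{i\theta\cdot x}\,d^nx\qquad(\theta\in\mathbb R^n).$$ The identity also holds in the sense of tempered distributions, and $\mathrm{Pr}_A$ is the only tempered distribution for which it does. The support of $\mathrm{Pr}_A$ is contained in $\prod_{j=1}^n S_j$, where $S_j=\{\frac1N(a_1+\dots+a_N): a_1,\dots,a_N\in\mathrm{spec}(A_j)\}$; for $N=1$ this is the product $\prod_j\mathrm{spec}(A_j)$ of the spectra. Moreover: 1. (Normalization) $\int_{\mathbb R^n}\mathrm{Pr}_A(x,\rho)\,d^nx=1$. 2. (Moments) For every multi-index $\alpha\in\mathbb N_0^n$, $$\int_{\mathbb R^n}x^\alpha\,\mathrm{Pr}_A(x,\rho)\,d^nx=\frac{1}{i^{|\alpha|}}\,\frac{\partial^{|\alpha|}}{\partial\theta_1^{\alpha_1}\cdots\partial\theta_n^{\alpha_n}}C_A(\theta,\rho)\Big|_{\theta=0}.$$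 3. (Reality) $\mathrm{Pr}_A$ is real (takes real values on real-valued test functions) if and only if $C_A(-\theta,\rho)=\overline{C_A(\theta,\rho)}$ for all $\theta\in\mathbb R^n$. If $\dim\mathcal H<\infty$, this condition is also equivalent to $\mathrm{Pr}_A$ being a finite signed measure. 4. (Classicality) $\mathrm{Pr}_A$ is a (nonnegative) probability measure if and only if $C_A(\cdot,\rho)$ is a positive definite function, i.e. $\sum_{j,k=1}^m c_j\overline{c_k}\,C_A(t_j-t_k,\rho)\ge 0$ for all $m$, all $t_1,\dots,t_m\in\mathbb R^n$ and all $c_1,\dots,c_m\in\mathbb C$. -/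

import Mathlib

open MeasureTheory Set Filter Topology
open scoped SchwartzMap FourierTransform ContDiff TensorProduct InnerProductSpace ComplexConjugate

noncomputable section

/-! ### The dual Hilbert space, states and canonical purifications -/

section Purification

universe u

variable {H : Type u} [NormedAddCommGroup H] [InnerProductSpace ℂ H] [CompleteSpace H]

variable (H) in
/-- The dual space `H*` of `H`, i.e. the space of bras, with the operator norm. -/
def BraSpace : Type u := StrongDual ℂ H

instance : NormedAddCommGroup (BraSpace H) :=
  inferInstanceAs (NormedAddCommGroup (StrongDual ℂ H))

instance : NormedSpace ℂ (BraSpace H) :=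
  inferInstanceAs (NormedSpace ℂ (StrongDual ℂ H))

/-- The bra `⟨x|`, i.e. the functional `y ↦ ⟨x|y⟩`; every element of `H*` is a bra. -/
def bra : H ≃ₗᵢ⋆[ℂ] BraSpace H := InnerProductSpace.toDual ℂ H

/-- The Hilbert space structure of `H*`: `(⟨ζ|, ⟨η|) = ⟨η|ζ⟩`. -/
instance : InnerProductSpace ℂ (BraSpace H) where
  inner f g := inner ℂ (bra.symm g) (bra.symm f)
  norm_sq_eq_re_inner f := by
    rw [← bra.symm.norm_map f]
    exact norm_sq_eq_re_inner _
  conj_inner_symm f g := inner_conj_symm _ _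
  add_left f g h := by rw [map_add, inner_add_right]
  smul_left f g c := by
    rw [map_smulₛₗ, inner_smul_right]

theorem inner_bra_bra (ζ η : H) : inner ℂ (bra ζ) (bra η) = inner ℂ η ζ := by
  change inner ℂ (bra.symm (bra η)) (bra.symm (bra ζ)) = _
  simp

variable (H) in
/-- The Hilbert space tensor product `H ⊗ H*` (completion of the algebraic tensor product). -/
abbrev HilbertTensorDual : Type u :=
  UniformSpace.Completion (H ⊗[ℂ] BraSpace H)

/-- The elementary tensor `x ⊗ ⟨y|` in `H ⊗ H*`. -/
def ketBra (x y : H) : HilbertTensorDual H :=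
  ((x ⊗ₜ[ℂ] bra y : H ⊗[ℂ] BraSpace H) : HilbertTensorDual H)

/-- The extension `X ⊗ 1` of a bounded operator `X` on `H` to `H ⊗ H*`. -/
def ampliation (X : H →L[ℂ] H) : HilbertTensorDual H →L[ℂ] HilbertTensorDual H :=
  (X.rTensor (BraSpace H)).completion

theorem ampliation_ketBra (X : H →L[ℂ] H) (x y : H) :
    ampliation X (ketBra x y) = ketBra (X x) y := by
  unfold ampliation ketBra
  simp

/-- `ρ` is a state (density operator): positive with unit trace, the trace being computed in any
orthonormal basis. -/
structure IsState (ρ : H →L[ℂ] H) : Prop where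
  isPositive : ρ.IsPositive
  trace_eq_one : ∀ (ι : Type u) (b : HilbertBasis ι ℂ H),
    HasSum (fun i => inner ℂ (b i) (ρ (b i))) 1

/-- `Ψ` is the canonical purification `∑ √λᵢ |αᵢ⟩ ⊗ ⟨αᵢ|` of `ρ` attached to a spectral
decomposition `ρ = ∑ λᵢ |αᵢ⟩⟨αᵢ|`. -/
def IsCanonicalPurification (ρ : H →L[ℂ] H) (Ψ : HilbertTensorDual H) : Prop :=
  ∃ (ι : Type u) (l : ι → ℝ) (α : ι → H), Orthonormal ℂ α ∧ (∀ i, 0 ≤ l i) ∧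
    (∀ x, HasSum (fun i => (l i : ℂ) • inner ℂ (α i) x • α i) (ρ x)) ∧
    HasSum (fun i => (Real.sqrt (l i) : ℂ) • ketBra (α i) (α i)) Ψ

/-! ### The multivariable quantum characteristic function -/

/-- The generalized unitary operator ordering function
`[∑_σ w(σ) e^{i θ_{σ(1)} A_{σ(1)} / N} ⋯ e^{i θ_{σ(n)} A_{σ(n)} / N}]^N`. -/
def unitaryOrdering {n : ℕ} (A : Fin n → H →L[ℂ] H) (N : ℕ) (w : Equiv.Perm (Fin n) → ℂ)
    (θ : EuclideanSpace ℝ (Fin n)) : H →L[ℂ] H :=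
  (∑ σ : Equiv.Perm (Fin n), w σ • (List.ofFn fun j : Fin n =>
    NormedSpace.exp ((Complex.I * (θ (σ j) : ℂ) / (N : ℂ)) • A (σ j))).prod) ^ N

/-- The multivariable quantum characteristic function `⟨Ψ| f̃(θ) ⊗ 1 |Ψ⟩`. -/
def qcf {n : ℕ} (A : Fin n → H →L[ℂ] H) (N : ℕ) (w : Equiv.Perm (Fin n) → ℂ)
    (Ψ : HilbertTensorDual H) (θ : EuclideanSpace ℝ (Fin n)) : ℂ :=
  inner ℂ Ψ (ampliation (unitaryOrdering A N w θ) Ψ)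

end Purification

/-! ### Distributions on `ℝⁿ` -/

section Distributions

variable {n : ℕ}

/-- The linear automorphism `x ↦ x / 2π` of `ℝⁿ`. -/
def scaleEquiv (n : ℕ) : EuclideanSpace ℝ (Fin n) ≃L[ℝ] EuclideanSpace ℝ (Fin n) :=
  ContinuousLinearEquiv.smulLeft (Units.mk0 (2 * Real.pi)⁻¹ (inv_ne_zero Real.two_pi_pos.ne'))

/-- The Fourier transform `φ̂(x) = ∫ e^{i θ·x} φ(θ) dθ` of a Schwartz function, as a Schwartz
function. -/
def charTransform (φ : 𝓢(EuclideanSpace ℝ (Fin n), ℂ)) : 𝓢(EuclideanSpace ℝ (Fin n), ℂ) :=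
  SchwartzMap.compCLMOfContinuousLinearEquiv ℂ (scaleEquiv n) (𝓕⁻ φ)

theorem charTransform_apply (φ : 𝓢(EuclideanSpace ℝ (Fin n), ℂ)) (x : EuclideanSpace ℝ (Fin n)) :
    charTransform φ x = ∫ θ, Complex.exp (Complex.I * (inner ℝ θ x : ℝ)) * φ θ := by
  have h : charTransform φ x = (𝓕⁻ (φ : EuclideanSpace ℝ (Fin n) → ℂ)) ((2 * Real.pi)⁻¹ • x) := by
    rw [← SchwartzMap.fourierInv_coe]
    rfl
  rw [h, Real.fourierInv_eq']
  congr 1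
  ext θ
  rw [inner_smul_right, smul_eq_mul]
  congr 2
  have : (Real.pi : ℂ) ≠ 0 := by exact_mod_cast Real.pi_ne_zero
  push_cast
  field_simp

/-- The function `C` (viewed as the tempered distribution `φ ↦ ∫ C φ`) is the Fourier transform
of the tempered distribution `u`, with the kernel `e^{i θ·x}`: `⟨C, φ⟩ = ⟨u, φ̂⟩`. -/
def IsFourierTransform (u : 𝓢'(EuclideanSpace ℝ (Fin n), ℂ))
    (C : EuclideanSpace ℝ (Fin n) → ℂ) : Prop :=
  ∀ φ : 𝓢(EuclideanSpace ℝ (Fin n), ℂ), ∫ θ, C θ * φ θ = u (charTransform φ)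

/-- `u` belongs to `ℰ'(ℝⁿ)`. -/
def IsCompactlySupported (u : 𝓢'(EuclideanSpace ℝ (Fin n), ℂ)) : Prop :=
  IsCompact (Distribution.dsupport u)

/-- For compactly supported `u` and smooth `g`: the pairing `⟨u, g⟩ = ∫ u(x) g(x) dx` is `c`.
It is the value of `u` at any Schwartz function which agrees with `g` near the support of `u`. -/
def HasIntegral (u : 𝓢'(EuclideanSpace ℝ (Fin n), ℂ)) (g : EuclideanSpace ℝ (Fin n) → ℂ)
    (c : ℂ) : Prop :=
  (∃ ψ : 𝓢(EuclideanSpace ℝ (Fin n), ℂ), ∀ᶠ x in 𝓝ˢ (Distribution.dsupport u), ψ x = g x) ∧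
  ∀ ψ : 𝓢(EuclideanSpace ℝ (Fin n), ℂ),
    (∀ᶠ x in 𝓝ˢ (Distribution.dsupport u), ψ x = g x) → u ψ = c

/-- `u` is real: it takes real values on real-valued test functions. -/
def IsRealDistribution (u : 𝓢'(EuclideanSpace ℝ (Fin n), ℂ)) : Prop :=
  ∀ φ : 𝓢(EuclideanSpace ℝ (Fin n), ℂ), (∀ x, (φ x).im = 0) → (u φ).im = 0

/-- `u` is a (nonnegative) probability measure. -/
def IsProbabilityDistribution (u : 𝓢'(EuclideanSpace ℝ (Fin n), ℂ)) : Prop :=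
  ∃ μ : Measure (EuclideanSpace ℝ (Fin n)), IsProbabilityMeasure μ ∧
    ∀ φ : 𝓢(EuclideanSpace ℝ (Fin n), ℂ), u φ = ∫ x, φ x ∂μ

/-- `u` is a finite signed measure. -/
def IsSignedMeasureDistribution (u : 𝓢'(EuclideanSpace ℝ (Fin n), ℂ)) : Prop :=
  ∃ s : SignedMeasure (EuclideanSpace ℝ (Fin n)), ∀ φ : 𝓢(EuclideanSpace ℝ (Fin n), ℂ),
    u φ = ∫ x, φ x ∂s.toJordanDecomposition.posPart - ∫ x, φ x ∂s.toJordanDecomposition.negPart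

/-- The partial derivative `∂/∂θ_j`. -/
def partialDeriv (j : Fin n) (f : EuclideanSpace ℝ (Fin n) → ℂ) :
    EuclideanSpace ℝ (Fin n) → ℂ :=
  fun θ => lineDeriv ℝ f θ (EuclideanSpace.single j 1)

/-- The mixed partial derivative `∂^{|α|} / ∂θ_1^{α_1} ⋯ ∂θ_n^{α_n}`. -/
def mixedPartialDeriv (α : Fin n → ℕ) (f : EuclideanSpace ℝ (Fin n) → ℂ) :
    EuclideanSpace ℝ (Fin n) → ℂ :=
  (List.finRange n).foldr (fun j g => (partialDeriv j)^[α j] g) f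

/-- `C` is a positive definite function on `ℝⁿ`: all the sums
`∑_{j,k} c_j \bar c_k C(t_j - t_k)` are real and nonnegative. -/
def IsPositiveDefiniteFunction (C : EuclideanSpace ℝ (Fin n) → ℂ) : Prop :=
  ∀ (m : ℕ) (t : Fin m → EuclideanSpace ℝ (Fin n)) (c : Fin m → ℂ),
    0 ≤ (∑ j, ∑ k, c j * conj (c k) * C (t j - t k)).re ∧
    (∑ j, ∑ k, c j * conj (c k) * C (t j - t k)).im = 0

/-- The set `(S + ⋯ + S) / N` of averages of `N` elements of `S`; it is `S` when `N = 1`. -/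
def averages (N : ℕ) (S : Set ℝ) : Set ℝ :=
  {y | ∃ s : Fin N → ℝ, (∀ k, s k ∈ S) ∧ y = (∑ k, s k) / N}

end Distributions

end

/-! The operators A_j need not commute, but the characteristic function sees them only through a
bounded multilinear form: opening up the N-th power, C_A(θ) is the value of `orderingForm`, which
has one slot per pair (r, j), at the exponentials e^{iθ_j A_j/N}. Right multiplications in different
slots commute as operators on the Banach space of multilinear forms, so there the product of
exponentials is the exponential of a sum. Passing to the bicommutant of the slot operators
(`exists_commutative_model`, `exists_jointExp_eq_qcf`) gives a commutative Banach algebra, elements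
B_1, …, B_n and a bounded functional l with C_A(θ) = l(e^{iθ·B}). Two facts survive the passage:
‖e^{iθ·B}‖ ≤ 1, because the exponentials in the slots are unitary, and every character sends B_j to
an average of N points of the real spectrum of A_j.

Such a tuple has a Schwartz functional calculus: φ(B) is the integral of e^{iθ·B} against the
inverse transform of φ. The group law makes it multiplicative, and Gelfand theory localizes it
(`jointCalculus_eq_zero`): if χ has no zero on a compact set K containing the joint spectrum, then
χ(B) is invertible, so χφ = 0 forces φ(B) = 0. The distribution is φ ↦ l(φ(B)). Functions that agree
near K with an exponential or a monomial have the expected values at B, which gives the Fourier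
identity, the normalization and the moments.

Uniqueness among tempered distributions holds because the Fourier transform is an automorphism of
Schwartz space. For the pointwise identity, the Fourier transform of a distribution fixed by a
Schwartz cutoff χ has a density (1 + |θ|²)^r g with g in L²; Fubini then writes the distribution as
a superposition of its pairings with e^{iτ·x}χ (`eq_zero_of_apply_exp_mul_eq_zero`).

Reality is invariance under conjugation, read on the Fourier side. In finite dimension C_A is a
trigonometric polynomial, so the distribution is a finite sum of point masses. For classicality,
positive definiteness gives ⟨Pr, |ψ|²⟩ ≥ 0 (`apply_smear_mul_smear_nonneg`); smooth approximate
square roots turn this into positivity on functions nonnegative on K, hence a bound by the supremum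
norm on K, and Hahn–Banach with Riesz–Markov produces the measure. -/

noncomputable section

/-! ### The Fourier transform as an automorphism of Schwartz space -/

section CharTransform

variable {n : ℕ}

/-- The transform `charTransform` as a continuous linear automorphism of the Schwartz space. -/
def charTransformEquiv (n : ℕ) :
    𝓢(EuclideanSpace ℝ (Fin n), ℂ) ≃L[ℂ] 𝓢(EuclideanSpace ℝ (Fin n), ℂ) :=
  (FourierTransform.fourierCLE ℂ 𝓢(EuclideanSpace ℝ (Fin n), ℂ)).symm.trans
    (ContinuousLinearEquiv.equivOfInverse
      (SchwartzMap.compCLMOfContinuousLinearEquiv ℂ (scaleEquiv n))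
      (SchwartzMap.compCLMOfContinuousLinearEquiv ℂ (scaleEquiv n).symm)
      (fun f => by ext x; simp) (fun f => by ext x; simp))

theorem charTransformEquiv_apply (φ : 𝓢(EuclideanSpace ℝ (Fin n), ℂ)) :
    charTransformEquiv n φ = charTransform φ := rfl

theorem charTransform_symm (φ : 𝓢(EuclideanSpace ℝ (Fin n), ℂ)) :
    charTransform ((charTransformEquiv n).symm φ) = φ :=
  (charTransformEquiv n).apply_symm_apply φ

theorem charTransformEquiv_symm_charTransform (φ : 𝓢(EuclideanSpace ℝ (Fin n), ℂ)) :
    (charTransformEquiv n).symm (charTransform φ) = φ :=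
  (charTransformEquiv n).symm_apply_apply φ

end CharTransform

/-! ### Smooth cutoffs and products of Schwartz functions -/

section Cutoff

variable {E : Type*} [NormedAddCommGroup E] [NormedSpace ℝ E]

/-- A real compactly supported smooth function as a complex valued Schwartz function. -/
def realSchwartz (χ : E → ℝ) (h : HasCompactSupport χ) (h' : ContDiff ℝ ∞ χ) : 𝓢(E, ℂ) :=
  (h.comp_left (g := Complex.ofReal) Complex.ofReal_zero).toSchwartzMap
    (Complex.ofRealCLM.contDiff.comp h')

theorem realSchwartz_apply (χ : E → ℝ) (h : HasCompactSupport χ) (h' : ContDiff ℝ ∞ χ) (x : E) :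
    realSchwartz χ h h' x = χ x := rfl

/-- The product of two Schwartz functions. -/
def schwartzMul (φ ψ : 𝓢(E, ℂ)) : 𝓢(E, ℂ) := SchwartzMap.smulLeftCLM ℂ φ ψ

theorem schwartzMul_apply (φ ψ : 𝓢(E, ℂ)) (x : E) : schwartzMul φ ψ x = φ x * ψ x :=
  SchwartzMap.smulLeftCLM_apply_apply φ.hasTemperateGrowth ψ x

variable [FiniteDimensional ℝ E]

/-- Smooth cutoff functions: equal to `1` near a compact set, supported in a given neighbourhood. -/
theorem exists_contDiff_cutoff {K U : Set E} (hK : IsCompact K) (hU : IsOpen U) (hKU : K ⊆ U) :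
    ∃ χ : E → ℝ, ContDiff ℝ ∞ χ ∧ HasCompactSupport χ ∧ tsupport χ ⊆ U ∧ (∀ x, 0 ≤ χ x) ∧
      (∀ x, χ x ≤ 1) ∧ ∀ᶠ x in 𝓝ˢ K, χ x = 1 := by
  obtain ⟨L, hL, hKL, hLU⟩ := exists_compact_between hK hU hKU
  obtain ⟨L', hL', hLL', hLU'⟩ := exists_compact_between hL hU hLU
  obtain ⟨χ, hχ, hr, h0, h1⟩ := exists_contMDiff_zero_iff_one_iff_of_isClosed (n := ⊤)
    (modelWithCornersSelf ℝ E) (isClosed_compl_iff.mpr (isOpen_interior (s := L'))) hL.isClosed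
    (by rw [disjoint_compl_left_iff_subset]; exact hLL')
  have hsupp : Function.support χ ⊆ L' := fun x hx => by
    by_contra h
    exact hx ((h0 x).1 fun h' => h (interior_subset h'))
  have hts : tsupport χ ⊆ L' := closure_minimal hsupp hL'.isClosed
  refine ⟨χ, hχ.contDiff, hL'.of_isClosed_subset (isClosed_tsupport χ) hts, hts.trans hLU',
    fun x => (hr ⟨x, rfl⟩).1, fun x => (hr ⟨x, rfl⟩).2, ?_⟩
  exact mem_of_superset (isOpen_interior.mem_nhdsSet.2 hKL)
    fun x hx => (h1 x).1 (interior_subset hx)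

theorem exists_schwartz_cutoff {K U : Set E} (hK : IsCompact K) (hU : IsOpen U) (hKU : K ⊆ U) :
    ∃ χ : 𝓢(E, ℂ), HasCompactSupport χ ∧ tsupport χ ⊆ U ∧ (∀ x, (χ x).im = 0) ∧
      (∀ x, ‖χ x‖ ≤ 1) ∧ ∀ᶠ x in 𝓝ˢ K, χ x = 1 := by
  obtain ⟨χ, h1, h2, h3, h4, h5, h6⟩ := exists_contDiff_cutoff hK hU hKU
  refine ⟨realSchwartz χ h2 h1, h2.comp_left (g := Complex.ofReal) Complex.ofReal_zero,
    (tsupport_comp_subset Complex.ofReal_zero χ).trans h3, fun x => by simp [realSchwartz_apply],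
    fun x => ?_, h6.mono fun x hx => by simp [realSchwartz_apply, hx]⟩
  rw [realSchwartz_apply, Complex.norm_real, Real.norm_of_nonneg (h4 x)]
  exact h5 x

end Cutoff

/-! ### Truncation of Schwartz functions -/

section Truncation

variable {E : Type*} [NormedAddCommGroup E] [NormedSpace ℝ E]

/-- Rescaled cutoffs of a Schwartz function converge to it in the Schwartz space. -/
theorem tendsto_smulLeftCLM_rescaled {χ : E → ℂ} (hχ : ContDiff ℝ ∞ χ) (hχc : HasCompactSupport χ)
    (hχ1 : ∀ x, ‖x‖ < 1 → χ x = 1) (φ : 𝓢(E, ℂ)) :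
    Tendsto (fun m : ℕ => SchwartzMap.smulLeftCLM ℂ (fun x => χ ((m + 1 : ℝ)⁻¹ • x)) φ) atTop
      (𝓝 φ) := by
  have hG : ∀ i : ℕ, ∃ G : ℝ, 0 ≤ G ∧ ∀ x, ‖iteratedFDeriv ℝ i (fun x => χ x - 1) x‖ ≤ G := by
    intro i
    have h1 : ContDiff ℝ ∞ (fun x => χ x - 1) := hχ.sub contDiff_const
    obtain ⟨G, hG⟩ := (hχc.iteratedFDeriv (𝕜 := ℝ) i).exists_bound_of_continuous
      (hχ.continuous_iteratedFDeriv (m := i) (by exact_mod_cast le_top))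
    refine ⟨G + ‖iteratedFDeriv ℝ i (fun _ : E => (1 : ℂ)) 0‖, by
      have := (norm_nonneg _).trans (hG 0); positivity, fun x => ?_⟩
    rw [show (fun x => χ x - 1) = χ - fun _ => (1 : ℂ) from rfl, iteratedFDeriv_sub_apply
      (hχ.contDiffAt.of_le (by exact_mod_cast le_top)) contDiffAt_const]
    refine (norm_sub_le _ _).trans (add_le_add (hG x) ?_)
    rcases Nat.eq_zero_or_pos i with rfl | hi
    · simp
    · rw [iteratedFDeriv_const_of_ne hi.ne']
      simp
  choose G hG0 hG using hG
  rw [(schwartz_withSeminorms ℝ E ℂ).tendsto_nhds]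
  rintro ⟨k, l⟩ ε hε
  -- The rescaled cutoff differs from 1 only where 1 ≤ c‖x‖. There a factor c is gained at the price
  -- of one more power of ‖x‖, which is why the seminorms have weight k + 1.
  set S : ℝ := ∑ i ∈ Finset.range (l + 1), (l.choose i : ℝ) * G i *
    SchwartzMap.seminorm ℝ (k + 1) (l - i) φ with hS
  have hS0 : 0 ≤ S := Finset.sum_nonneg fun i _ =>
    mul_nonneg (mul_nonneg (Nat.cast_nonneg _) (hG0 i)) (apply_nonneg _ _)
  have hlim : Tendsto (fun m : ℕ => (m + 1 : ℝ)⁻¹ * S) atTop (𝓝 0) := by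
    have := (tendsto_one_div_add_atTop_nhds_zero_nat (𝕜 := ℝ)).mul_const S
    simpa using this
  filter_upwards [hlim.eventually (gt_mem_nhds hε)] with m hm
  refine lt_of_le_of_lt ?_ hm
  have hpos : (0 : ℝ) < (m + 1 : ℝ)⁻¹ := by positivity
  have hle1 : (m + 1 : ℝ)⁻¹ ≤ 1 := inv_le_one_of_one_le₀ (by linarith [Nat.cast_nonneg (α := ℝ) m])
  set c : ℝ := (m + 1 : ℝ)⁻¹ with hc
  have hχm : ContDiff ℝ ∞ (fun x => χ (c • x)) := hχ.comp (contDiff_const_smul c)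
  have hχmc : HasCompactSupport (fun x => χ (c • x)) := hχc.comp_smul hpos.ne'
  have hg : ContDiff ℝ ∞ (fun x => χ (c • x) - 1) := hχm.sub contDiff_const
  have heq : ⇑(SchwartzMap.smulLeftCLM ℂ (fun x => χ (c • x)) φ - φ) =
      fun x => (χ (c • x) - 1) * φ x := by
    ext x
    rw [sub_apply, SchwartzMap.smulLeftCLM_apply_apply (hχmc.hasTemperateGrowth hχm)]
    simp [sub_mul]
  have hgb : ∀ i x, ‖iteratedFDeriv ℝ i (fun x => χ (c • x) - 1) x‖ ≤ G i := by
    intro i x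
    have h1 : (fun x => χ (c • x) - 1) =
        (fun x => χ x - 1) ∘ (c • ContinuousLinearMap.id ℝ E) := by ext; simp
    rw [h1, ContinuousLinearMap.iteratedFDeriv_comp_right _ (hχ.sub contDiff_const) _
      (i := i) (by exact_mod_cast le_top)]
    refine (ContinuousMultilinearMap.norm_compContinuousLinearMap_le _ _).trans ?_
    refine (mul_le_of_le_one_right (norm_nonneg _) ?_).trans (hG i _)
    refine Finset.prod_le_one (fun _ _ => norm_nonneg _) fun _ _ => ?_
    refine (norm_smul_le _ _).trans ?_
    rw [Real.norm_of_nonneg hpos.le]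
    exact mul_le_one₀ hle1 (norm_nonneg _) ContinuousLinearMap.norm_id_le
  refine SchwartzMap.seminorm_le_bound ℝ k l _ (mul_nonneg hpos.le hS0) fun x => ?_
  rw [heq]
  by_cases hx : c * ‖x‖ < 1
  · have hev : (fun x => (χ (c • x) - 1) * φ x) =ᶠ[𝓝 x] fun _ => 0 := by
      have : ∀ᶠ y in 𝓝 x, c * ‖y‖ < 1 :=
        (continuous_const.mul continuous_norm).continuousAt.eventually (gt_mem_nhds hx)
      filter_upwards [this] with y hy
      rw [hχ1 _ (by rwa [norm_smul, Real.norm_of_nonneg hpos.le]), sub_self, zero_mul]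
    rw [(hev.iteratedFDeriv ℝ l).eq_of_nhds]
    have : iteratedFDeriv ℝ l (fun _ : E => (0 : ℂ)) x = 0 := by simp
    rw [this, norm_zero, mul_zero]
    exact mul_nonneg hpos.le hS0
  · push Not at hx
    have h2 := norm_iteratedFDeriv_mul_le (n := l) (N := ∞) hg (φ.smooth ⊤) x
      (by exact_mod_cast le_top)
    calc ‖x‖ ^ k * ‖iteratedFDeriv ℝ l (fun x => (χ (c • x) - 1) * φ x) x‖
        ≤ ‖x‖ ^ k * ∑ i ∈ Finset.range (l + 1), (l.choose i : ℝ) *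
          ‖iteratedFDeriv ℝ i (fun x => χ (c • x) - 1) x‖ * ‖iteratedFDeriv ℝ (l - i) φ x‖ := by
          gcongr
      _ ≤ (c * ‖x‖) * (‖x‖ ^ k * ∑ i ∈ Finset.range (l + 1), (l.choose i : ℝ) *
          G i * ‖iteratedFDeriv ℝ (l - i) φ x‖) := by
          refine le_trans ?_ (le_mul_of_one_le_left ?_ hx)
          · gcongr with i _
            exact hgb i x
          · exact mul_nonneg (by positivity) (Finset.sum_nonneg fun i _ =>
              mul_nonneg (mul_nonneg (Nat.cast_nonneg _) (hG0 i)) (norm_nonneg _))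
      _ = c * ∑ i ∈ Finset.range (l + 1), (l.choose i : ℝ) * G i *
          (‖x‖ ^ (k + 1) * ‖iteratedFDeriv ℝ (l - i) φ x‖) := by
          rw [mul_assoc, ← mul_assoc ‖x‖, Finset.mul_sum]
          congr 1
          refine Finset.sum_congr rfl fun i _ => by ring
      _ ≤ c * S := by
          rw [hS]
          gcongr with i _
          · exact mul_nonneg (Nat.cast_nonneg _) (hG0 i)
          · exact SchwartzMap.le_seminorm ℝ (k + 1) (l - i) φ x

end Truncation

/-! ### Distributions and their supports -/

section Support

theorem tsupport_subset_of_eventually_eq_zero {E : Type*} [TopologicalSpace E] {f : E → ℂ}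
    {D : Set E}
    (h : ∀ᶠ x in 𝓝ˢ D, f x = 0) : tsupport f ⊆ Dᶜ := by
  intro x hx hxD
  have := (eventually_nhdsSet_iff_forall.1 h) x hxD
  exact (notMem_tsupport_iff_eventuallyEq.2 this) hx

variable {E : Type*} [NormedAddCommGroup E] [NormedSpace ℝ E] [FiniteDimensional ℝ E]

/-- A tempered distribution vanishes on compactly supported functions supported away from its
distributional support. -/
theorem apply_eq_zero_of_hasCompactSupport (u : 𝓢'(E, ℂ)) (φ : 𝓢(E, ℂ))
    (hφ : HasCompactSupport φ) (h : tsupport φ ⊆ (Distribution.dsupport u)ᶜ) : u φ = 0 := by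
  suffices H : ∃ U : Set E, IsOpen U ∧ tsupport φ ⊆ U ∧
      ∀ ψ : 𝓢(E, ℂ), HasCompactSupport ψ → tsupport ψ ⊆ U → u ψ = 0 by
    obtain ⟨U, _, hU, hu⟩ := H
    exact hu φ hφ hU
  refine IsCompact.induction_on (p := fun s => ∃ U : Set E, IsOpen U ∧ s ⊆ U ∧
      ∀ ψ : 𝓢(E, ℂ), HasCompactSupport ψ → tsupport ψ ⊆ U → u ψ = 0) hφ ?_ ?_ ?_ ?_
  · refine ⟨∅, isOpen_empty, subset_rfl, fun ψ _ hψ => ?_⟩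
    have : ψ = 0 := by
      ext x
      exact image_eq_zero_of_notMem_tsupport fun hx => hψ hx
    rw [this, map_zero]
  · rintro s t hst ⟨U, hU, htU, hu⟩
    exact ⟨U, hU, hst.trans htU, hu⟩
  · rintro s t ⟨U, hU, hsU, hu⟩ ⟨V, hV, htV, hv⟩
    refine ⟨U ∪ V, hU.union hV, union_subset_union hsU htV, fun ψ hψ hψUV => ?_⟩
    -- Partition of unity for two sets: with χ equal to 1 near K₁ and supported in U, the remainder
    -- (1 - χ)ψ is supported in K₂.
    obtain ⟨K₁, K₂, hK₁, hK₂, hK₁U, hK₂V, hK⟩ :=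
      IsCompact.binary_compact_cover (K := tsupport ψ) hψ hU hV hψUV
    obtain ⟨χ, hχc, hχU, -, -, hχ1⟩ := exists_schwartz_cutoff hK₁ hU hK₁U
    have hdec : ψ = schwartzMul χ ψ + (ψ - schwartzMul χ ψ) := by abel
    have h1 : u (schwartzMul χ ψ) = 0 := by
      have hcoe : ⇑(schwartzMul χ ψ) = fun x => χ x * ψ x := funext (schwartzMul_apply χ ψ)
      refine hu _ ?_ ?_
      · rw [hcoe]; exact hχc.mul_right
      · rw [hcoe]; exact (tsupport_mul_subset_left (f := χ)).trans hχU
    have h2 : u (ψ - schwartzMul χ ψ) = 0 := by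
      have hcoe : ⇑(ψ - schwartzMul χ ψ) = fun x => (1 - χ x) * ψ x := by
        ext x; simp [schwartzMul_apply, sub_mul]
      refine hv _ ?_ ?_
      · rw [hcoe]; exact hψ.mul_left
      · intro x hx
        rw [hcoe] at hx
        have hxψ : x ∈ tsupport ψ := tsupport_mul_subset_right (g := ψ) hx
        have hx1 : x ∉ K₁ := fun hx1 => by
          refine (tsupport_subset_of_eventually_eq_zero (D := K₁) ?_) hx hx1
          filter_upwards [hχ1] with y hy
          simp [hy]
        rw [hK] at hxψ
        exact hK₂V (hxψ.resolve_left hx1)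
    rw [hdec, map_add, h1, h2, add_zero]
  · intro x hx
    obtain ⟨s, hs, hso, hxs⟩ := (Distribution.notMem_dsupport_iff x).1 (h hx)
    exact ⟨s, mem_nhdsWithin_of_mem_nhds (hso.mem_nhds hxs), s, hso, subset_rfl,
      fun ψ _ hψ => hs ψ hψ⟩

/-- A tempered distribution vanishes on Schwartz functions which vanish near its support. -/
theorem apply_eq_zero_of_eventually_eq_zero (u : 𝓢'(E, ℂ)) (φ : 𝓢(E, ℂ))
    (h : ∀ᶠ x in 𝓝ˢ (Distribution.dsupport u), φ x = 0) : u φ = 0 := by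
  -- Since φ may lack compact support, it is replaced by truncations, which converge to it in
  -- Schwartz space.
  obtain ⟨χ, hχ, hχc, -, -, -, hχ1⟩ := exists_contDiff_cutoff
    (isCompact_closedBall (0 : E) 1) isOpen_univ (subset_univ _)
  have hχ' : ContDiff ℝ ∞ (fun x => (χ x : ℂ)) := Complex.ofRealCLM.contDiff.comp hχ
  have hχc' : HasCompactSupport (fun x => (χ x : ℂ)) :=
    hχc.comp_left (g := Complex.ofReal) Complex.ofReal_zero
  have hlim := tendsto_smulLeftCLM_rescaled hχ' hχc' (fun x hx => by
    rw [(eventually_nhdsSet_iff_forall.1 hχ1 x (by simpa using hx.le)).self_of_nhds]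
    simp) φ
  have hlim' := (u.continuous.tendsto φ).comp hlim
  refine tendsto_nhds_unique hlim' (tendsto_const_nhds.congr fun m => ?_)
  have hpos : (0 : ℝ) < (m + 1 : ℝ)⁻¹ := by positivity
  have hm : ContDiff ℝ ∞ (fun x => (χ ((m + 1 : ℝ)⁻¹ • x) : ℂ)) :=
    hχ'.comp (contDiff_const_smul _)
  have hmc : HasCompactSupport (fun x => (χ ((m + 1 : ℝ)⁻¹ • x) : ℂ)) := hχc'.comp_smul hpos.ne'
  have hcoe := SchwartzMap.smulLeftCLM_apply (F := ℂ) (hmc.hasTemperateGrowth hm) φ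
  symm
  apply apply_eq_zero_of_hasCompactSupport
  · rw [hcoe]; exact hmc.smul_right
  · rw [hcoe]
    exact (tsupport_smul_subset_right _ _).trans (tsupport_subset_of_eventually_eq_zero h)

theorem apply_congr_of_eventually_eq (u : 𝓢'(E, ℂ)) {φ ψ : 𝓢(E, ℂ)}
    (h : ∀ᶠ x in 𝓝ˢ (Distribution.dsupport u), φ x = ψ x) : u φ = u ψ := by
  rw [← sub_eq_zero, ← map_sub]
  refine apply_eq_zero_of_eventually_eq_zero u _ (h.mono fun x hx => ?_)
  rw [sub_apply, hx, sub_self]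

end Support

/-! ### Exponential groups in a commutative Banach algebra -/

section JointExp

variable {𝔄 : Type*} [NormedCommRing 𝔄] [NormedAlgebra ℂ 𝔄] {n : ℕ}

/-- The group `θ ↦ exp (i ∑ⱼ θⱼ Bⱼ)` generated by elements of a commutative Banach algebra. -/
def jointExp (B : Fin n → 𝔄) (θ : EuclideanSpace ℝ (Fin n)) : 𝔄 :=
  NormedSpace.exp (∑ j, (Complex.I * (θ j : ℂ)) • B j)

/-- The linear map `θ ↦ i ∑ⱼ θⱼ Bⱼ`. -/
def jointGenerator (B : Fin n → 𝔄) : EuclideanSpace ℝ (Fin n) →L[ℝ] 𝔄 :=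
  ∑ j, (EuclideanSpace.proj (𝕜 := ℝ) j : EuclideanSpace ℝ (Fin n) →L[ℝ] ℝ).smulRight
    (Complex.I • B j)

theorem jointExp_eq (B : Fin n → 𝔄) (θ : EuclideanSpace ℝ (Fin n)) :
    jointExp B θ = NormedSpace.exp (jointGenerator B θ) := by
  rw [jointExp]
  congr 1
  simp only [jointGenerator, sum_apply, ContinuousLinearMap.smulRight_apply,
    PiLp.proj_apply]
  refine Finset.sum_congr rfl fun j _ => ?_
  rw [mul_comm, mul_smul, Complex.coe_smul]

theorem jointExp_zero (B : Fin n → 𝔄) : jointExp B 0 = 1 := by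
  rw [jointExp_eq, map_zero, NormedSpace.exp_zero]

variable [CompleteSpace 𝔄]

theorem jointExp_add (B : Fin n → 𝔄) (s t : EuclideanSpace ℝ (Fin n)) :
    jointExp B (s + t) = jointExp B s * jointExp B t := by
  let _ := NormedAlgebra.restrictScalars ℚ ℂ 𝔄
  rw [jointExp_eq, jointExp_eq, jointExp_eq, map_add, NormedSpace.exp_add]

theorem contDiff_jointExp (B : Fin n → 𝔄) : ContDiff ℝ ∞ (jointExp B) := by
  have h : AnalyticOnNhd ℝ (NormedSpace.exp : 𝔄 → 𝔄) univ := fun x _ =>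
    (NormedSpace.exp_analytic (𝕂 := ℂ) x).restrictScalars
  have h' : ContDiff ℝ ∞ (NormedSpace.exp : 𝔄 → 𝔄) :=
    contDiffOn_univ.1 (h.contDiffOn uniqueDiffOn_univ)
  rw [show jointExp B = _ ∘ _ from funext (jointExp_eq B)]
  exact h'.comp (jointGenerator B).contDiff

theorem hasLineDerivAt_jointExp (B : Fin n → 𝔄) (j : Fin n) (θ : EuclideanSpace ℝ (Fin n)) :
    HasLineDerivAt ℝ (jointExp B) (Complex.I • B j * jointExp B θ) θ
      (EuclideanSpace.single j 1) := by
  have h1 : HasFDerivAt (jointExp B)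
      ((NormedSpace.exp (jointGenerator B θ) • (1 : 𝔄 →L[ℝ] 𝔄)).comp (jointGenerator B)) θ := by
    have := (hasStrictFDerivAt_exp (𝕂 := ℝ) (x := jointGenerator B θ)).hasFDerivAt.comp θ
      (jointGenerator B).hasFDerivAt
    refine this.congr_of_eventuallyEq (Eventually.of_forall fun θ => jointExp_eq B θ)
  have h2 := h1.hasLineDerivAt (EuclideanSpace.single j 1)
  have h3 : jointGenerator B (EuclideanSpace.single j 1) = Complex.I • B j := by
    simp only [jointGenerator, sum_apply, ContinuousLinearMap.smulRight_apply,
      PiLp.proj_apply]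
    rw [Finset.sum_eq_single j] <;> simp +contextual
  have h4 : Complex.I • B j * jointExp B θ = ((NormedSpace.exp (jointGenerator B θ) •
      (1 : 𝔄 →L[ℝ] 𝔄)).comp (jointGenerator B)) (EuclideanSpace.single j 1) := by
    rw [ContinuousLinearMap.comp_apply, h3, ← jointExp_eq, smul_apply,
      one_apply_eq_self, smul_eq_mul, mul_comm]
  rw [h4]
  exact h2

theorem map_jointExp {𝔅 F : Type*} [NormedCommRing 𝔅] [NormedAlgebra ℂ 𝔅] [FunLike F 𝔄 𝔅]
    [AlgHomClass F ℂ 𝔄 𝔅] (f : F) (hf : Continuous f) (B : Fin n → 𝔄)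
    (θ : EuclideanSpace ℝ (Fin n)) : f (jointExp B θ) = jointExp (fun j => f (B j)) θ := by
  let _ := NormedAlgebra.restrictScalars ℚ ℂ 𝔄
  let _ := NormedAlgebra.restrictScalars ℚ ℂ 𝔅
  rw [jointExp, NormedSpace.map_exp f hf, map_sum]
  simp only [map_smul, jointExp]

theorem jointExp_complex (x θ : EuclideanSpace ℝ (Fin n)) :
    jointExp (fun j => (x j : ℂ)) θ = Complex.exp (Complex.I * (inner ℝ θ x : ℝ)) := by
  rw [jointExp, Complex.exp_eq_exp_ℂ]
  congr 1
  rw [PiLp.inner_apply]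
  push_cast
  rw [Finset.mul_sum]
  refine Finset.sum_congr rfl fun j _ => ?_
  simp only [smul_eq_mul, RCLike.inner_apply, conj_trivial]
  push_cast
  ring

end JointExp

/-! ### Smearing a bounded group with Schwartz functions -/

section Smear

variable {𝔄 : Type*} [NormedCommRing 𝔄] [NormedAlgebra ℂ 𝔄] {n : ℕ}
  {B : Fin n → 𝔄} {M : ℝ}

/-- The integral `∫ f(θ) exp (i θ·B) dθ`. -/
def smear (B : Fin n → 𝔄) (f : 𝓢(EuclideanSpace ℝ (Fin n), ℂ)) : 𝔄 := ∫ θ, f θ • jointExp B θ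

theorem smear_smul (c : ℂ) (f : 𝓢(EuclideanSpace ℝ (Fin n), ℂ)) :
    smear B (c • f) = c • smear B f := by
  simp only [smear, smul_apply, smul_assoc]
  exact integral_smul c _

variable [CompleteSpace 𝔄]

theorem integrable_smear (hM : ∀ θ, ‖jointExp B θ‖ ≤ M) (f : 𝓢(EuclideanSpace ℝ (Fin n), ℂ)) :
    Integrable fun θ => f θ • jointExp B θ :=
  f.integrable.smul_bdd M (contDiff_jointExp B).continuous.aestronglyMeasurable
    (Eventually.of_forall hM)

theorem map_smear {𝔅 F : Type*} [NormedCommRing 𝔅] [NormedAlgebra ℂ 𝔅] [CompleteSpace 𝔅]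
    [FunLike F 𝔄 𝔅] [AlgHomClass F ℂ 𝔄 𝔅] (f : F) (hf : Continuous f)
    (hM : ∀ θ, ‖jointExp B θ‖ ≤ M) (g : 𝓢(EuclideanSpace ℝ (Fin n), ℂ)) :
    f (smear B g) = smear (fun j => f (B j)) g := by
  let L : 𝔄 →L[ℂ] 𝔅 := ⟨(AlgHomClass.toAlgHom f : 𝔄 →ₐ[ℂ] 𝔅).toLinearMap, hf⟩
  have := L.integral_comp_comm (integrable_smear hM g)
  change L _ = _
  rw [smear, ← this]
  simp only [smear]
  congr 1
  ext θ
  rw [map_smul]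
  congr 1
  exact map_jointExp f hf B θ

theorem smear_add (hM : ∀ θ, ‖jointExp B θ‖ ≤ M) (f g : 𝓢(EuclideanSpace ℝ (Fin n), ℂ)) :
    smear B (f + g) = smear B f + smear B g := by
  simp only [smear, add_apply, add_smul]
  exact integral_add (integrable_smear hM f) (integrable_smear hM g)

/-- Integration by parts moves the derivative onto the group, where it brings down the generator. -/
theorem smear_lineDeriv (hM : ∀ θ, ‖jointExp B θ‖ ≤ M) (f : 𝓢(EuclideanSpace ℝ (Fin n), ℂ))
    (j : Fin n) : smear B (LineDeriv.lineDerivOp (EuclideanSpace.single j (1 : ℝ)) f) =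
      -(Complex.I • B j * smear B f) := by
  have hint : ∀ f : 𝓢(EuclideanSpace ℝ (Fin n), ℂ),
      Integrable fun θ => f θ • (Complex.I • B j * jointExp B θ) := fun f => by
    simpa only [mul_smul_comm] using (integrable_smear hM f).const_mul (Complex.I • B j)
  have := integral_bilinear_hasLineDerivAt_right_eq_neg_left_of_integrable (μ := volume)
    (B := (ContinuousLinearMap.lsmul ℝ ℂ : ℂ →L[ℝ] 𝔄 →L[ℝ] 𝔄)) (f := f) (g := jointExp B)
    (f' := LineDeriv.lineDerivOp (EuclideanSpace.single j (1 : ℝ)) f)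
    (g' := fun θ => Complex.I • B j * jointExp B θ) (v := EuclideanSpace.single j 1)
    (integrable_smear hM _) (hint f) (integrable_smear hM f)
    (fun x _ => by
      rw [SchwartzMap.lineDerivOp_apply_eq_fderiv]
      exact (f.hasFDerivAt x).hasLineDerivAt _)
    (fun x _ => hasLineDerivAt_jointExp B j x)
  simp only [ContinuousLinearMap.lsmul_apply] at this
  rw [smear, ← neg_eq_iff_eq_neg.2 this, smear,
    ← integral_const_mul_of_integrable (integrable_smear hM f)]
  simp only [mul_smul_comm]

theorem smear_translate (f : 𝓢(EuclideanSpace ℝ (Fin n), ℂ)) (τ : EuclideanSpace ℝ (Fin n))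
    (hM : ∀ θ, ‖jointExp B θ‖ ≤ M) :
    smear B (SchwartzMap.compSubConstCLM ℂ τ f) = jointExp B τ * smear B f := by
  rw [smear, ← integral_add_right_eq_self _ τ, smear,
    ← integral_const_mul_of_integrable (integrable_smear hM f)]
  congr 1
  ext θ
  simp [jointExp_add, mul_comm]

/-- Fubini, a translation of the variable and the group law split the double integral into a
product. -/
theorem smear_convolution (hM : ∀ θ, ‖jointExp B θ‖ ≤ M)
    (f g : 𝓢(EuclideanSpace ℝ (Fin n), ℂ)) :
    smear B (SchwartzMap.convolution (ContinuousLinearMap.mul ℂ ℂ) f g) =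
      smear B f * smear B g := by
  have hM0 : 0 ≤ M := (norm_nonneg _).trans (hM 0)
  calc smear B (SchwartzMap.convolution (ContinuousLinearMap.mul ℂ ℂ) f g)
      = ∫ v, ∫ s, (f s * g (v - s)) • jointExp B v := by
        rw [smear]
        congr 1
        ext v
        rw [SchwartzMap.convolution_apply, convolution_def, ← integral_smul_const]
        rfl
    _ = ∫ s, ∫ v, (f s * g (v - s)) • jointExp B v := by
        refine integral_integral_swap ?_
        have h1 : Integrable (fun p : EuclideanSpace ℝ (Fin n) × EuclideanSpace ℝ (Fin n) =>
            f p.2 * g (p.1 - p.2)) (volume.prod volume) :=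
          f.integrable.convolution_integrand (ContinuousLinearMap.mul ℂ ℂ) g.integrable
        exact h1.smul_bdd M ((contDiff_jointExp B).continuous.comp
          continuous_fst).aestronglyMeasurable (Eventually.of_forall fun p => hM p.1)
    _ = ∫ s, (f s • jointExp B s) * smear B g := by
        congr 1
        ext s
        rw [← integral_add_right_eq_self _ s, smear,
          ← integral_const_mul_of_integrable (integrable_smear hM g)]
        congr 1
        ext v
        rw [add_sub_cancel_right, jointExp_add, mul_smul, smul_mul_smul_comm,
          mul_comm (jointExp B v), smul_smul, mul_smul]
    _ = smear B f * smear B g := integral_mul_const_of_integrable (integrable_smear hM f)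

/-- The scalar case of smearing is the Fourier transform, so each identity for `smear` specializes
to one for `charTransform`. -/
theorem smear_complex (x : EuclideanSpace ℝ (Fin n)) (f : 𝓢(EuclideanSpace ℝ (Fin n), ℂ)) :
    smear (fun j => (x j : ℂ)) f = charTransform f x := by
  rw [charTransform_apply, smear]
  congr 1
  ext θ
  rw [jointExp_complex, smul_eq_mul, mul_comm]

theorem norm_jointExp_complex (x θ : EuclideanSpace ℝ (Fin n)) :
    ‖jointExp (fun j => (x j : ℂ)) θ‖ ≤ 1 := by
  rw [jointExp_complex, mul_comm, Complex.norm_exp_ofReal_mul_I]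

end Smear

/-! ### Schwartz functional calculus and localization on the joint spectrum -/

section JointCalculus

variable {𝔄 : Type*} [NormedCommRing 𝔄] [NormedAlgebra ℂ 𝔄] [CompleteSpace 𝔄] {n : ℕ}
  {B : Fin n → 𝔄} {M : ℝ}

/-- The Schwartz functional calculus `φ ↦ φ(B)` of a tuple generating a bounded group. -/
def jointCalculus (B : Fin n → 𝔄) (φ : 𝓢(EuclideanSpace ℝ (Fin n), ℂ)) : 𝔄 :=
  smear B ((charTransformEquiv n).symm φ)

theorem charTransform_convolution (f g : 𝓢(EuclideanSpace ℝ (Fin n), ℂ)) :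
    charTransform (SchwartzMap.convolution (ContinuousLinearMap.mul ℂ ℂ) f g) =
      schwartzMul (charTransform f) (charTransform g) := by
  ext x
  rw [schwartzMul_apply, ← smear_complex, ← smear_complex, ← smear_complex,
    smear_convolution (norm_jointExp_complex x)]

theorem jointCalculus_mul (hM : ∀ θ, ‖jointExp B θ‖ ≤ M)
    (φ ψ : 𝓢(EuclideanSpace ℝ (Fin n), ℂ)) :
    jointCalculus B (schwartzMul φ ψ) = jointCalculus B φ * jointCalculus B ψ := by
  rw [jointCalculus, jointCalculus, jointCalculus, ← smear_convolution hM]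
  congr 1
  rw [ContinuousLinearEquiv.symm_apply_eq, charTransformEquiv_apply, charTransform_convolution,
    charTransform_symm, charTransform_symm]

theorem charTransform_translate (f : 𝓢(EuclideanSpace ℝ (Fin n), ℂ))
    (τ x : EuclideanSpace ℝ (Fin n)) :
    charTransform (SchwartzMap.compSubConstCLM ℂ τ f) x =
      Complex.exp (Complex.I * (inner ℝ τ x : ℝ)) * charTransform f x := by
  rw [← smear_complex, smear_translate f τ (norm_jointExp_complex x), jointExp_complex,
    smear_complex]

theorem jointCalculus_exp_mul (hM : ∀ θ, ‖jointExp B θ‖ ≤ M) (τ : EuclideanSpace ℝ (Fin n))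
    {φ ψ : 𝓢(EuclideanSpace ℝ (Fin n), ℂ)}
    (h : ∀ x, ψ x = Complex.exp (Complex.I * (inner ℝ τ x : ℝ)) * φ x) :
    jointCalculus B ψ = jointExp B τ * jointCalculus B φ := by
  rw [jointCalculus, jointCalculus, ← smear_translate _ _ hM]
  congr 1
  rw [ContinuousLinearEquiv.symm_apply_eq, charTransformEquiv_apply]
  ext x
  rw [charTransform_translate, charTransform_symm, h]

theorem charTransform_lineDeriv (f : 𝓢(EuclideanSpace ℝ (Fin n), ℂ)) (j : Fin n)
    (x : EuclideanSpace ℝ (Fin n)) :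
    charTransform (LineDeriv.lineDerivOp (EuclideanSpace.single j (1 : ℝ)) f) x =
      -(Complex.I * (x j : ℂ) * charTransform f x) := by
  rw [← smear_complex, smear_lineDeriv (norm_jointExp_complex x), smear_complex, smul_eq_mul]

theorem jointCalculus_coord_mul (hM : ∀ θ, ‖jointExp B θ‖ ≤ M) (j : Fin n)
    {φ ψ : 𝓢(EuclideanSpace ℝ (Fin n), ℂ)} (h : ∀ x, ψ x = (x j : ℂ) * φ x) :
    jointCalculus B ψ = B j * jointCalculus B φ := by
  have h1 : (charTransformEquiv n).symm ψ = Complex.I • LineDeriv.lineDerivOp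
      (EuclideanSpace.single j (1 : ℝ)) ((charTransformEquiv n).symm φ) := by
    rw [ContinuousLinearEquiv.symm_apply_eq, map_smul, charTransformEquiv_apply]
    ext x
    rw [smul_apply, charTransform_lineDeriv, charTransform_symm, h, smul_eq_mul]
    linear_combination ((x j : ℂ) * φ x) * Complex.I_mul_I
  rw [jointCalculus, h1, smear_smul, smear_lineDeriv hM, jointCalculus, smul_neg, smul_mul_assoc,
    smul_smul, Complex.I_mul_I, neg_smul, neg_neg, one_smul]

theorem jointCalculus_add (hM : ∀ θ, ‖jointExp B θ‖ ≤ M)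
    (φ ψ : 𝓢(EuclideanSpace ℝ (Fin n), ℂ)) :
    jointCalculus B (φ + ψ) = jointCalculus B φ + jointCalculus B ψ := by
  rw [jointCalculus, map_add, smear_add hM]; rfl

theorem jointCalculus_sub (hM : ∀ θ, ‖jointExp B θ‖ ≤ M)
    (φ ψ : 𝓢(EuclideanSpace ℝ (Fin n), ℂ)) :
    jointCalculus B (φ - ψ) = jointCalculus B φ - jointCalculus B ψ := by
  rw [eq_sub_iff_add_eq, ← jointCalculus_add hM, sub_add_cancel]

/-- A continuous character commutes with the integral and reduces the calculus to its scalar case.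
-/
theorem character_jointCalculus (hM : ∀ θ, ‖jointExp B θ‖ ≤ M)
    (χ : WeakDual.characterSpace ℂ 𝔄) (x : EuclideanSpace ℝ (Fin n)) (hx : ∀ j, χ (B j) = x j)
    (φ : 𝓢(EuclideanSpace ℝ (Fin n), ℂ)) : χ (jointCalculus B φ) = φ x := by
  rw [jointCalculus, map_smear χ (map_continuous χ) hM]
  simp only [hx]
  rw [smear_complex, charTransform_symm]

variable {K : Set (EuclideanSpace ℝ (Fin n))}

/-- The tuple `B` has real joint spectrum contained in `K`. -/
def JointSpectrumSubset (B : Fin n → 𝔄) (K : Set (EuclideanSpace ℝ (Fin n))) : Prop :=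
  ∀ χ : WeakDual.characterSpace ℂ 𝔄, ∃ x ∈ K, ∀ j, χ (B j) = x j

theorem isUnit_jointCalculus (hM : ∀ θ, ‖jointExp B θ‖ ≤ M) (hB : JointSpectrumSubset B K)
    {φ : 𝓢(EuclideanSpace ℝ (Fin n), ℂ)} (h : ∀ x ∈ K, φ x ≠ 0) :
    IsUnit (jointCalculus B φ) := by
  by_contra hn
  obtain ⟨χ, hχ⟩ := WeakDual.CharacterSpace.exists_apply_eq_zero hn
  obtain ⟨x, hxK, hx⟩ := hB χ
  rw [character_jointCalculus hM χ x hx] at hχ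
  exact h x hxK hχ

/-- A cutoff χ living where φ vanishes, with χ = 1 on K, satisfies χφ = 0 while χ(B) is invertible;
multiplicativity then kills φ(B). -/
theorem jointCalculus_eq_zero (hM : ∀ θ, ‖jointExp B θ‖ ≤ M) (hB : JointSpectrumSubset B K)
    (hK : IsCompact K) {φ : 𝓢(EuclideanSpace ℝ (Fin n), ℂ)} (h : ∀ᶠ x in 𝓝ˢ K, φ x = 0) :
    jointCalculus B φ = 0 := by
  obtain ⟨U, hU, hKU, hφ⟩ := eventually_nhdsSet_iff_exists.1 h
  obtain ⟨χ, -, hχU, -, -, hχ1⟩ := exists_schwartz_cutoff hK hU hKU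
  have h0 : schwartzMul χ φ = 0 := by
    ext x
    rw [schwartzMul_apply]
    by_cases hx : x ∈ U
    · rw [hφ x hx, mul_zero]; rfl
    · rw [image_eq_zero_of_notMem_tsupport fun h => hx (hχU h), zero_mul]; rfl
  have h1 := jointCalculus_mul hM χ φ
  have h2 : jointCalculus B (0 : 𝓢(EuclideanSpace ℝ (Fin n), ℂ)) = 0 := by
    have := jointCalculus_sub hM χ χ
    rwa [sub_self, sub_self] at this
  rw [h0, h2] at h1
  refine ((isUnit_jointCalculus hM hB fun x hx => ?_).mul_right_eq_zero).1 h1.symm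
  rw [(eventually_nhdsSet_iff_forall.1 hχ1 x hx).self_of_nhds]
  exact one_ne_zero

/-- Here χφ = χ for a cutoff χ with χ(B) invertible, and χ(B) can be cancelled. -/
theorem jointCalculus_eq_one (hM : ∀ θ, ‖jointExp B θ‖ ≤ M) (hB : JointSpectrumSubset B K)
    (hK : IsCompact K) {φ : 𝓢(EuclideanSpace ℝ (Fin n), ℂ)} (h : ∀ᶠ x in 𝓝ˢ K, φ x = 1) :
    jointCalculus B φ = 1 := by
  obtain ⟨U, hU, hKU, hφ⟩ := eventually_nhdsSet_iff_exists.1 h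
  obtain ⟨χ, -, hχU, -, -, hχ1⟩ := exists_schwartz_cutoff hK hU hKU
  have h0 : schwartzMul χ φ = χ := by
    ext x
    rw [schwartzMul_apply]
    by_cases hx : x ∈ U
    · rw [hφ x hx, mul_one]
    · rw [image_eq_zero_of_notMem_tsupport fun h => hx (hχU h), zero_mul]
  have h1 := jointCalculus_mul hM χ φ
  rw [h0] at h1
  have hu : IsUnit (jointCalculus B χ) := isUnit_jointCalculus hM hB fun x hx => by
    rw [(eventually_nhdsSet_iff_forall.1 hχ1 x hx).self_of_nhds]
    exact one_ne_zero
  exact hu.mul_left_cancel (by rw [← h1, mul_one])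

theorem jointCalculus_congr (hM : ∀ θ, ‖jointExp B θ‖ ≤ M) (hB : JointSpectrumSubset B K)
    (hK : IsCompact K) {φ ψ : 𝓢(EuclideanSpace ℝ (Fin n), ℂ)} (h : ∀ᶠ x in 𝓝ˢ K, φ x = ψ x) :
    jointCalculus B φ = jointCalculus B ψ := by
  rw [← sub_eq_zero, ← jointCalculus_sub hM]
  refine jointCalculus_eq_zero hM hB hK (h.mono fun x hx => ?_)
  rw [sub_apply, hx, sub_self]

/-- A smooth function on `ℝⁿ` cut off near a compact set. -/
theorem exists_schwartz_eq_near (hK : IsCompact K) {g : EuclideanSpace ℝ (Fin n) → ℂ}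
    (hg : ContDiff ℝ ∞ g) :
    ∃ φ : 𝓢(EuclideanSpace ℝ (Fin n), ℂ), ∀ᶠ x in 𝓝ˢ K, φ x = g x := by
  obtain ⟨χ, hχ, -, -, -, hχ1⟩ := exists_schwartz_cutoff hK isOpen_univ (subset_univ K)
  refine ⟨(hχ.mul_right (f' := g)).toSchwartzMap ((χ.smooth ⊤).mul hg), hχ1.mono fun x hx => ?_⟩
  change χ x * g x = g x
  rw [hx, one_mul]

theorem jointCalculus_eq_jointExp (hM : ∀ θ, ‖jointExp B θ‖ ≤ M) (hB : JointSpectrumSubset B K)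
    (hK : IsCompact K) (τ : EuclideanSpace ℝ (Fin n)) {φ : 𝓢(EuclideanSpace ℝ (Fin n), ℂ)}
    (h : ∀ᶠ x in 𝓝ˢ K, φ x = Complex.exp (Complex.I * (inner ℝ τ x : ℝ))) :
    jointCalculus B φ = jointExp B τ := by
  obtain ⟨χ, hχ⟩ := exists_schwartz_eq_near hK (contDiff_const (c := (1 : ℂ)))
  set f := SchwartzMap.compSubConstCLM ℂ τ ((charTransformEquiv n).symm χ)
  have hf : ∀ x, charTransform f x = Complex.exp (Complex.I * (inner ℝ τ x : ℝ)) * χ x :=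
    fun x => by rw [charTransform_translate, charTransform_symm]
  have h1 := jointCalculus_exp_mul hM τ hf
  rw [jointCalculus_eq_one hM hB hK hχ, mul_one] at h1
  rw [← h1]
  refine jointCalculus_congr hM hB hK ?_
  filter_upwards [h, hχ] with x hx hx'
  rw [hx, hf, hx', mul_one]

theorem jointCalculus_eq_monomial (hM : ∀ θ, ‖jointExp B θ‖ ≤ M) (hB : JointSpectrumSubset B K)
    (hK : IsCompact K) (α : Fin n → ℕ) {φ : 𝓢(EuclideanSpace ℝ (Fin n), ℂ)}
    (h : ∀ᶠ x in 𝓝ˢ K, φ x = ((∏ j, x j ^ α j : ℝ) : ℂ)) :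
    jointCalculus B φ = ∏ j, B j ^ α j := by
  -- A monomial is not Schwartz, so the induction runs over smooth g and all Schwartz functions
  -- equal to g near K; each coordinate factor contributes one B_j.
  have step : ∀ (j : Fin n) (b : 𝔄) (g : EuclideanSpace ℝ (Fin n) → ℂ), ContDiff ℝ ∞ g →
      (∀ φ : 𝓢(EuclideanSpace ℝ (Fin n), ℂ), (∀ᶠ x in 𝓝ˢ K, φ x = g x) →
        jointCalculus B φ = b) →
      ∀ φ : 𝓢(EuclideanSpace ℝ (Fin n), ℂ), (∀ᶠ x in 𝓝ˢ K, φ x = (x j : ℂ) * g x) →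
        jointCalculus B φ = B j * b := by
    intro j b g hg ih φ hφ
    obtain ⟨ψ, hψ⟩ := exists_schwartz_eq_near hK hg
    have hj : (fun x : EuclideanSpace ℝ (Fin n) => (x j : ℂ)).HasTemperateGrowth :=
      (Complex.ofRealCLM.comp (EuclideanSpace.proj (𝕜 := ℝ) j :
        EuclideanSpace ℝ (Fin n) →L[ℝ] ℝ)).hasTemperateGrowth
    rw [← ih ψ hψ, ← jointCalculus_coord_mul hM j (φ := ψ)
      (ψ := SchwartzMap.smulLeftCLM ℂ (fun x : EuclideanSpace ℝ (Fin n) => (x j : ℂ)) ψ)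
      fun x => SchwartzMap.smulLeftCLM_apply_apply hj ψ x]
    refine jointCalculus_congr hM hB hK ?_
    filter_upwards [hφ, hψ] with x hx hx'
    rw [hx, SchwartzMap.smulLeftCLM_apply_apply hj, hx', smul_eq_mul]
  have hcoord : ∀ j, ContDiff ℝ ∞ fun x : EuclideanSpace ℝ (Fin n) => (x j : ℂ) := fun j =>
    (Complex.ofRealCLM.comp (EuclideanSpace.proj (𝕜 := ℝ) j :
        EuclideanSpace ℝ (Fin n) →L[ℝ] ℝ)).contDiff
  have main : ∀ s : Finset (Fin n), ∀ φ : 𝓢(EuclideanSpace ℝ (Fin n), ℂ),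
      (∀ᶠ x in 𝓝ˢ K, φ x = ∏ j ∈ s, (x j : ℂ) ^ α j) →
      jointCalculus B φ = ∏ j ∈ s, B j ^ α j := by
    intro s
    induction s using Finset.induction_on with
    | empty =>
      intro φ hφ
      simpa using jointCalculus_eq_one hM hB hK (by simpa using hφ)
    | insert j s hj ih =>
      have hs : ContDiff ℝ ∞ fun x : EuclideanSpace ℝ (Fin n) => ∏ j ∈ s, (x j : ℂ) ^ α j :=
        contDiff_prod fun i _ => (hcoord i).pow _
      have : ∀ k : ℕ, ∀ φ : 𝓢(EuclideanSpace ℝ (Fin n), ℂ),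
          (∀ᶠ x in 𝓝ˢ K, φ x = (x j : ℂ) ^ k * ∏ j ∈ s, (x j : ℂ) ^ α j) →
          jointCalculus B φ = B j ^ k * ∏ j ∈ s, B j ^ α j := by
        intro k
        induction k with
        | zero => simpa using ih
        | succ k ihk =>
          intro φ hφ
          rw [pow_succ', mul_assoc]
          refine step j _ _ (((hcoord j).pow k).mul hs) ihk φ (hφ.mono fun x hx => ?_)
          rw [hx, pow_succ', mul_assoc]
      intro φ hφ
      rw [Finset.prod_insert hj]
      exact this _ φ (hφ.mono fun x hx => by rw [hx, Finset.prod_insert hj])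
  refine main _ φ (h.mono fun x hx => ?_)
  rw [hx]
  push_cast
  rfl

end JointCalculus

/-! ### Moments as derivatives at the origin -/

section Derivatives

variable {𝔄 : Type*} [NormedCommRing 𝔄] [NormedAlgebra ℂ 𝔄] [CompleteSpace 𝔄] {n : ℕ}

theorem partialDeriv_iterate_jointExp (B : Fin n → 𝔄) (l : 𝔄 →L[ℂ] ℂ) (b : 𝔄) (j : Fin n) (k : ℕ) :
    (partialDeriv j)^[k] (fun θ => l (b * jointExp B θ)) =
      fun θ => l ((Complex.I • B j) ^ k * b * jointExp B θ) := by
  induction k with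
  | zero => simp
  | succ k ih =>
    rw [Function.iterate_succ_apply', ih]
    ext θ
    set c := (Complex.I • B j) ^ k * b
    have h : HasLineDerivAt ℝ (fun θ => l (c * jointExp B θ))
        (l (c * (Complex.I • B j * jointExp B θ))) θ (EuclideanSpace.single j 1) := by
      have h1 := hasLineDerivAt_jointExp B j θ
      have h2 := (((ContinuousLinearMap.mul ℂ 𝔄 c).restrictScalars ℝ).hasFDerivAt
        (x := jointExp B (θ + (0 : ℝ) • EuclideanSpace.single j 1))).comp_hasDerivAt (0 : ℝ) h1
      exact ((l.restrictScalars ℝ).hasFDerivAt).comp_hasDerivAt (0 : ℝ) h2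
    change lineDeriv ℝ _ θ _ = _
    rw [h.lineDeriv, pow_succ']
    congr 1
    simp only [c]
    ring

theorem mixedPartialDeriv_jointExp (B : Fin n → 𝔄) (l : 𝔄 →L[ℂ] ℂ) (α : Fin n → ℕ) :
    mixedPartialDeriv α (fun θ => l (jointExp B θ)) =
      fun θ => l ((∏ j, (Complex.I • B j) ^ α j) * jointExp B θ) := by
  have : ∀ L : List (Fin n), L.foldr (fun j g => (partialDeriv j)^[α j] g)
      (fun θ => l (jointExp B θ)) =
      fun θ => l ((L.map fun j => (Complex.I • B j) ^ α j).prod * jointExp B θ) := by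
    intro L
    induction L with
    | nil => simp
    | cons j L ih =>
      rw [List.foldr_cons, ih, partialDeriv_iterate_jointExp, List.map_cons, List.prod_cons]
  rw [mixedPartialDeriv, this, ← Fin.prod_univ_def]

theorem moment_eq_mixedPartialDeriv (B : Fin n → 𝔄) (l : 𝔄 →L[ℂ] ℂ) (α : Fin n → ℕ) :
    (1 / Complex.I ^ (∑ j, α j)) * mixedPartialDeriv α (fun θ => l (jointExp B θ)) 0 =
      l (∏ j, B j ^ α j) := by
  rw [mixedPartialDeriv_jointExp]
  beta_reduce
  rw [jointExp_zero, mul_one]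
  simp only [smul_pow]
  rw [Finset.prod_smul, Finset.prod_pow_eq_pow_sum, map_smul, smul_eq_mul, ← mul_assoc,
    one_div, inv_mul_cancel₀ (pow_ne_zero _ Complex.I_ne_zero), one_mul]

end Derivatives

/-! ### Spectra in the bicommutant -/

section Bicommutant

/-- Commuting elements of a Banach algebra lie in a commutative Banach subalgebra in which they
have the same spectrum, namely their bicommutant. -/
theorem exists_commutative_subalgebra {𝔅 : Type*} [NormedRing 𝔅] [NormedAlgebra ℂ 𝔅]
    [CompleteSpace 𝔅] {ι : Type*} (a : ι → 𝔅) (ha : ∀ i j, Commute (a i) (a j)) :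
    ∃ (𝔄 : Subalgebra ℂ 𝔅) (_ : ∀ x y : 𝔄, x * y = y * x) (b : ι → 𝔄), CompleteSpace 𝔄 ∧
      (∀ i, (b i : 𝔅) = a i) ∧ ∀ i, spectrum ℂ (b i) ⊆ spectrum ℂ (a i) := by
  have hsub : range a ⊆ (range a).centralizer := by
    rintro _ ⟨i, rfl⟩ _ ⟨j, rfl⟩
    exact ha j i
  let 𝔄 := Subalgebra.centralizer ℂ (range a).centralizer
  have hmem : ∀ i, a i ∈ 𝔄 := fun i => subset_centralizer_centralizer ⟨i, rfl⟩
  refine ⟨𝔄, fun x y => Subtype.ext ?_, fun i => ⟨a i, hmem i⟩, ?_, fun i => rfl, fun i z hz => ?_⟩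
  · exact (y.2 _ (centralizer_subset hsub x.2))
  · exact (isClosed_centralizer (range a).centralizer).completeSpace_coe
  · rw [spectrum.mem_iff] at hz ⊢
    intro hu
    apply hz
    obtain ⟨v, hv⟩ := hu
    -- The bicommutant is closed under inverses: whatever commutes with z - a i commutes with its
    -- inverse.
    have hvmem : (↑v⁻¹ : 𝔅) ∈ 𝔄 := by
      intro x hx
      have h1 : Commute x (v : 𝔅) := by
        rw [hv]
        exact Commute.sub_right (Algebra.commutes z x).symm (hx (a i) ⟨i, rfl⟩).symm
      exact h1.units_inv_right
    refine ⟨⟨algebraMap ℂ 𝔄 z - ⟨a i, hmem i⟩, ⟨_, hvmem⟩, Subtype.ext ?_, Subtype.ext ?_⟩, rfl⟩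
    · change (algebraMap ℂ 𝔅 z - a i) * _ = 1
      rw [← hv, Units.mul_inv]
    · change _ * (algebraMap ℂ 𝔅 z - a i) = 1
      rw [← hv, Units.inv_mul]

end Bicommutant

/-! ### Commuting slot operators on multilinear maps -/

section Slots

universe u

/-- Elements placed in different slots commute, so the exponential of the sum is a product of
exponentials; each continuous homomorphism `h i` passes through its exponential, and the single-slot
tuples multiply to the full tuple. -/
theorem exp_sum_eq_map_exp {R 𝔅 ι : Type*} [NormedRing R] [NormedAlgebra ℂ R] [CompleteSpace R]
    [NormedRing 𝔅] [NormedAlgebra ℂ 𝔅] [CompleteSpace 𝔅] [Fintype ι] [DecidableEq ι]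
    (g : (ι → R) →* 𝔅) (h : ι → R →ₐ[ℂ] 𝔅) (hg : ∀ i x, h i x = g (Pi.mulSingle i x))
    {C : ι → ℝ} (hc : ∀ i x, ‖h i x‖ ≤ C i * ‖x‖) (X : ι → R) :
    NormedSpace.exp (∑ i, h i (X i)) = g fun i => NormedSpace.exp (X i) := by
  let _ := NormedAlgebra.restrictScalars ℚ ℂ R
  let _ := NormedAlgebra.restrictScalars ℚ ℂ 𝔅
  have hcomm : ((Finset.univ : Finset ι) : Set ι).Pairwise
      (Function.onFun Commute fun i => h i (X i)) := fun i _ j _ hij => by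
    rw [Function.onFun, hg, hg]
    exact (Pi.mulSingle_commute hij (X i) (X j)).map g
  have e := Finset.map_noncommProd Finset.univ
    (fun i => (Pi.mulSingle i (NormedSpace.exp (X i)) : ι → R))
    (fun i _ j _ _ => Pi.mulSingle_apply_commute (fun i => NormedSpace.exp (X i)) i j) g
  rw [Finset.noncommProd_mulSingle] at e
  rw [NormedSpace.exp_sum_of_commute Finset.univ _ hcomm, e]
  refine Finset.noncommProd_congr rfl (fun i _ => ?_) _
  rw [← hg, NormedSpace.map_exp (h i) (AddMonoidHomClass.continuous_of_bound (h i) _ (hc i))]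

variable {R F ι : Type*} [NormedRing R] [NormedAlgebra ℂ R] [NormedAddCommGroup F]
  [NormedSpace ℂ F] [Fintype ι]

variable (R F ι) in
/-- The Banach space of bounded multilinear maps `R × ⋯ × R → F`. -/
def SlotSpace : Type _ := ContinuousMultilinearMap ℂ (fun _ : ι => R) F

instance : NormedAddCommGroup (SlotSpace R F ι) :=
  inferInstanceAs (NormedAddCommGroup (ContinuousMultilinearMap ℂ (fun _ : ι => R) F))

instance : NormedSpace ℂ (SlotSpace R F ι) :=
  inferInstanceAs (NormedSpace ℂ (ContinuousMultilinearMap ℂ (fun _ : ι => R) F))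

instance [CompleteSpace F] : CompleteSpace (SlotSpace R F ι) :=
  inferInstanceAs (CompleteSpace (ContinuousMultilinearMap ℂ (fun _ : ι => R) F))

/-- Evaluation of a multilinear map. -/
def slotEval (Y : ι → R) : SlotSpace R F ι →L[ℂ] F :=
  ContinuousMultilinearMap.apply ℂ (fun _ : ι => R) F Y

theorem slotEval_ext {Φ Φ' : SlotSpace R F ι} (h : ∀ Y, slotEval Y Φ = slotEval Y Φ') : Φ = Φ' :=
  ContinuousMultilinearMap.ext h

theorem slotEval_update_add [DecidableEq ι] (Φ : SlotSpace R F ι) (Y : ι → R) (i : ι) (x y : R) :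
    slotEval (Function.update Y i (x + y)) Φ =
      slotEval (Function.update Y i x) Φ + slotEval (Function.update Y i y) Φ :=
  ContinuousMultilinearMap.map_update_add Φ Y i x y

theorem slotEval_update_smul [DecidableEq ι] (Φ : SlotSpace R F ι) (Y : ι → R) (i : ι) (c : ℂ)
    (x : R) : slotEval (Function.update Y i (c • x)) Φ =
      c • slotEval (Function.update Y i x) Φ :=
  ContinuousMultilinearMap.map_update_smul Φ Y i c x

/-- Right multiplication by `X i` in the `i`-th slot of a multilinear map. -/
def slotMul (X : ι → R) : SlotSpace R F ι →L[ℂ] SlotSpace R F ι :=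
  LinearMap.mkContinuous
    { toFun := fun Φ => ContinuousMultilinearMap.compContinuousLinearMap Φ
        fun i => (ContinuousLinearMap.mul ℂ R).flip (X i)
      map_add' := fun _ _ => rfl
      map_smul' := fun _ _ => rfl }
    (∏ i, ‖X i‖) fun Φ => by
      rw [mul_comm]
      refine (ContinuousMultilinearMap.norm_compContinuousLinearMap_le _ _).trans ?_
      refine mul_le_mul_of_nonneg_left ?_ (norm_nonneg _)
      refine Finset.prod_le_prod (fun _ _ => norm_nonneg _) fun i _ => ?_
      refine ContinuousLinearMap.opNorm_le_bound _ (norm_nonneg _) fun y => ?_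
      rw [ContinuousLinearMap.flip_apply, ContinuousLinearMap.mul_apply', mul_comm ‖X i‖]
      exact norm_mul_le _ _

theorem slotEval_slotMul (X Y : ι → R) (Φ : SlotSpace R F ι) :
    slotEval Y (slotMul X Φ) = slotEval (fun i => Y i * X i) Φ := rfl

theorem norm_slotMul_le (X : ι → R) : ‖slotMul (F := F) X‖ ≤ ∏ i, ‖X i‖ :=
  LinearMap.mkContinuous_norm_le _ (Finset.prod_nonneg fun _ _ => norm_nonneg _) _

variable (R F ι) in
/-- `slotMul` as a homomorphism of monoids. -/
def slotMulHom : (ι → R) →* (SlotSpace R F ι →L[ℂ] SlotSpace R F ι) where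
  toFun := slotMul
  map_one' := by
    ext1 Φ
    refine slotEval_ext fun Y => ?_
    simp [slotEval_slotMul]
  -- Right multiplication preserves the order: applying X' and then X to Φ evaluates Φ at Y X X'.
  map_mul' X X' := by
    ext1 Φ
    refine slotEval_ext fun Y => ?_
    simp [slotEval_slotMul, mul_assoc]

variable [DecidableEq ι]

variable (R F) in
/-- Right multiplication in a single slot, as a homomorphism of algebras. -/
def slotHom (i : ι) : R →ₐ[ℂ] (SlotSpace R F ι →L[ℂ] SlotSpace R F ι) :=
  have h : ∀ (Y : ι → R) (Z : R), (fun k => Y k * (Pi.mulSingle i Z : ι → R) k) =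
      Function.update Y i (Y i * Z) := fun Y Z => by
    ext k
    rcases eq_or_ne k i with rfl | hk <;> simp [*]
  AlgHom.ofLinearMap
    { toFun := fun X => slotMulHom R F ι (Pi.mulSingle i X)
      map_add' := fun X X' => by
        ext1 Φ
        refine slotEval_ext fun Y => ?_
        simp only [slotMulHom, MonoidHom.coe_mk, OneHom.coe_mk, add_apply, map_add,
          slotEval_slotMul, h, mul_add, slotEval_update_add]
      map_smul' := fun c X => by
        ext1 Φ
        refine slotEval_ext fun Y => ?_
        simp only [slotMulHom, MonoidHom.coe_mk, OneHom.coe_mk, smul_apply, map_smul,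
          slotEval_slotMul, h, mul_smul_comm, slotEval_update_smul, RingHom.id_apply] }
    (by
      change slotMulHom R F ι (Pi.mulSingle i 1) = 1
      rw [Pi.mulSingle_one, map_one])
    (fun X X' => by
      change slotMulHom R F ι (Pi.mulSingle i (X * X')) = _
      rw [Pi.mulSingle_mul, map_mul]
      rfl)

theorem slotHom_apply (i : ι) (X : R) :
    slotHom R F i X = slotMulHom R F ι (Pi.mulSingle i X) := rfl

/-- Each of the other slots holds 1, whose norm is not assumed to be 1. Only continuity of `slotHom`
is wanted from this bound. -/
theorem norm_slotHom_le (i : ι) (X : R) :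
    ‖slotHom R F i X‖ ≤ ‖(1 : R)‖ ^ (Fintype.card ι - 1) * ‖X‖ := by
  refine (norm_slotMul_le _).trans ?_
  rw [← Finset.mul_prod_erase _ _ (Finset.mem_univ i), Pi.mulSingle_eq_same, mul_comm]
  gcongr
  rw [Finset.prod_congr rfl (g := fun _ => ‖(1 : R)‖), Finset.prod_const,
    Finset.card_erase_of_mem (Finset.mem_univ i), Finset.card_univ]
  intro k hk
  rw [Pi.mulSingle_eq_of_ne (Finset.ne_of_mem_erase hk)]

theorem commute_of_eq_map_mulSingle {R 𝔅 ι : Type*} [Monoid R] [Monoid 𝔅] [DecidableEq ι]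
    (g : (ι → R) →* 𝔅) {h : ι → R → 𝔅} (hg : ∀ i x, h i x = g (Pi.mulSingle i x))
    {i j : ι} (hij : i ≠ j) (x y : R) : Commute (h i x) (h j y) := by
  rw [hg, hg]
  exact (Pi.mulSingle_commute hij x y).map g

/-- The values of a bounded multilinear map at `(exp (c₁ a₁), exp (c₂ a₂), …)` are the values of a
bounded functional at `exp (c₁ b₁ + c₂ b₂ + …)`, where the `bᵢ` are elements of a commutative Banach
algebra with `spec(bᵢ) ⊆ spec(aᵢ)`. -/
theorem exists_commutative_model {R : Type u} [NormedRing R] [NormedAlgebra ℂ R] [CompleteSpace R]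
    {ι : Type} [Fintype ι] (Φ : ContinuousMultilinearMap ℂ (fun _ : ι => R) ℂ) (a : ι → R) :
    ∃ (𝔄 : Type u) (_ : NormedCommRing 𝔄) (_ : NormedAlgebra ℂ 𝔄) (_ : CompleteSpace 𝔄)
      (b : ι → 𝔄) (l : 𝔄 →L[ℂ] ℂ), (∀ i, spectrum ℂ (b i) ⊆ spectrum ℂ (a i)) ∧
      ∀ c : ι → ℂ, ‖NormedSpace.exp (∑ i, c i • b i)‖ ≤ ∏ i, ‖NormedSpace.exp (c i • a i)‖ ∧
        l (NormedSpace.exp (∑ i, c i • b i)) = Φ fun i => NormedSpace.exp (c i • a i) := by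
  classical
  have hcomm : ∀ i j, Commute (slotHom R ℂ i (a i)) (slotHom R ℂ j (a j)) := fun i j => by
    rcases eq_or_ne i j with rfl | hij
    · exact Commute.refl _
    · exact commute_of_eq_map_mulSingle (slotMulHom R ℂ ι) slotHom_apply hij _ _
  obtain ⟨𝔄, hmul, b, hcomp, hb, hspec⟩ := exists_commutative_subalgebra _ hcomm
  let _ : NormedCommRing 𝔄 := { (inferInstance : NormedRing 𝔄) with mul_comm := hmul }
  have hexp : ∀ c : ι → ℂ, ((NormedSpace.exp (∑ i, c i • b i) : 𝔄) :
      SlotSpace R ℂ ι →L[ℂ] SlotSpace R ℂ ι) =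
      slotMul fun i => NormedSpace.exp (c i • a i) := fun c => by
    let _ := NormedAlgebra.restrictScalars ℚ ℂ 𝔄
    let _ := NormedAlgebra.restrictScalars ℚ ℂ (SlotSpace R ℂ ι →L[ℂ] SlotSpace R ℂ ι)
    change 𝔄.val _ = _
    rw [NormedSpace.map_exp 𝔄.val continuous_subtype_val, map_sum]
    refine Eq.trans ?_ (exp_sum_eq_map_exp (slotMulHom R ℂ ι) (slotHom R ℂ) slotHom_apply
      (norm_slotHom_le (F := ℂ)) fun i => c i • a i)
    congr 1
    refine Finset.sum_congr rfl fun i _ => ?_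
    rw [map_smul, map_smul]
    exact congrArg _ (hb i)
  -- The functional lets an operator act on Φ and evaluates at (1, …, 1), so `slotMul X` is sent to
  -- Φ X.
  let l : 𝔄 →L[ℂ] ℂ := ((slotEval (1 : ι → R)).comp
    (ContinuousLinearMap.apply ℂ (SlotSpace R ℂ ι) (Φ : SlotSpace R ℂ ι))).comp
      𝔄.toSubmodule.subtypeL
  refine ⟨𝔄, inferInstance, inferInstance, hcomp, b, l, fun i => (hspec i).trans ?_,
    fun c => ⟨?_, ?_⟩⟩
  -- A unital homomorphism preserves invertibility, so spectra cannot grow.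
  · exact AlgHom.spectrum_apply_subset (slotHom R ℂ i) (a i)
  · refine le_trans (le_of_eq ?_) (norm_slotMul_le (F := ℂ) _)
    rw [← hexp]
    rfl
  · change slotEval (1 : ι → R) (((NormedSpace.exp (∑ i, c i • b i) : 𝔄) :
      SlotSpace R ℂ ι →L[ℂ] SlotSpace R ℂ ι) (Φ : SlotSpace R ℂ ι)) = _
    rw [hexp]
    refine (slotEval_slotMul _ _ _).trans ?_
    simp only [Pi.one_apply, one_mul]
    rfl

end Slots

/-! ### The characteristic function as a multilinear form, and its commutative model -/

section OrderingForm

universe u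

variable {H : Type u} [NormedAddCommGroup H] [InnerProductSpace ℂ H] [CompleteSpace H] {n : ℕ}

theorem ampliation_coe (X : H →L[ℂ] H) (x : H ⊗[ℂ] BraSpace H) :
    ampliation X (x : HilbertTensorDual H) =
      ((X.rTensor (BraSpace H) x : H ⊗[ℂ] BraSpace H) : HilbertTensorDual H) :=
  ContinuousLinearMap.completion_apply_coe _ _

theorem ampliation_one (Φ : HilbertTensorDual H) : ampliation (1 : H →L[ℂ] H) Φ = Φ := by
  induction Φ using UniformSpace.Completion.induction_on with
  | hp => exact isClosed_eq (ampliation (1 : H →L[ℂ] H)).continuous continuous_id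
  | ih x => rw [ampliation_coe, ContinuousLinearMap.rTensor_one, one_apply_eq_self]

theorem ampliation_add (X Y : H →L[ℂ] H) (Φ : HilbertTensorDual H) :
    ampliation (X + Y) Φ = ampliation X Φ + ampliation Y Φ := by
  induction Φ using UniformSpace.Completion.induction_on with
  | hp =>
    exact isClosed_eq (ampliation (X + Y)).continuous
      ((ampliation X).continuous.add (ampliation Y).continuous)
  | ih x =>
    rw [ampliation_coe, ampliation_coe, ampliation_coe, ContinuousLinearMap.rTensor_add,
      add_apply, UniformSpace.Completion.coe_add]

theorem ampliation_smul (c : ℂ) (X : H →L[ℂ] H) (Φ : HilbertTensorDual H) :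
    ampliation (c • X) Φ = c • ampliation X Φ := by
  induction Φ using UniformSpace.Completion.induction_on with
  | hp =>
    exact isClosed_eq (ampliation (c • X)).continuous ((ampliation X).continuous.const_smul c)
  | ih x =>
    rw [ampliation_coe, ampliation_coe, ContinuousLinearMap.rTensor_smul, smul_apply,
      UniformSpace.Completion.coe_smul]

theorem norm_ampliation_apply_le (X : H →L[ℂ] H) (Φ : HilbertTensorDual H) :
    ‖ampliation X Φ‖ ≤ ‖X‖ * ‖Φ‖ := by
  induction Φ using UniformSpace.Completion.induction_on with
  | hp =>
    exact isClosed_le (ampliation X).continuous.norm (continuous_const.mul continuous_norm)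
  | ih x =>
    rw [ampliation_coe, UniformSpace.Completion.norm_coe, UniformSpace.Completion.norm_coe]
    exact (ContinuousLinearMap.le_opNorm _ _).trans
      (mul_le_mul_of_nonneg_right (ContinuousLinearMap.norm_rTensor_le _ _) (norm_nonneg _))

/-- The linear map `X ↦ ⟨Ψ|X ⊗ 1|Ψ⟩`. -/
def purificationExpectation (Ψ : HilbertTensorDual H) : (H →L[ℂ] H) →L[ℂ] ℂ :=
  LinearMap.mkContinuous
    { toFun := fun X => inner ℂ Ψ (ampliation X Ψ)
      map_add' := fun X Y => by rw [ampliation_add, inner_add_right]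
      map_smul' := fun c X => by rw [ampliation_smul, inner_smul_right]; rfl }
    (‖Ψ‖ * ‖Ψ‖) fun X => by
      refine (norm_inner_le_norm (𝕜 := ℂ) Ψ (ampliation X Ψ)).trans ?_
      calc ‖Ψ‖ * ‖ampliation X Ψ‖ ≤ ‖Ψ‖ * (‖X‖ * ‖Ψ‖) := by
            gcongr
            exact norm_ampliation_apply_le X Ψ
        _ = _ := by ring

theorem purificationExpectation_apply (Ψ : HilbertTensorDual H) (X : H →L[ℂ] H) :
    purificationExpectation Ψ X = inner ℂ Ψ (ampliation X Ψ) := rfl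

/-- The multilinear form `(Y_{r,k}) ↦ ⟨Ψ|(∏_r ∑_σ w(σ) Y_{r,σ(1)} ⋯ Y_{r,σ(n)}) ⊗ 1|Ψ⟩`. -/
def orderingForm (Ψ : HilbertTensorDual H) (N : ℕ) (w : Equiv.Perm (Fin n) → ℂ) :
    ContinuousMultilinearMap ℂ (fun _ : (Σ _ : Fin N, Fin n) => H →L[ℂ] H) ℂ where
  toMultilinearMap := (purificationExpectation Ψ).toLinearMap.compMultilinearMap
    ((MultilinearMap.mkPiAlgebraFin ℂ N (H →L[ℂ] H)).compMultilinearMap fun _ : Fin N =>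
      ∑ σ : Equiv.Perm (Fin n),
        w σ • (MultilinearMap.mkPiAlgebraFin ℂ n (H →L[ℂ] H)).domDomCongr σ)
  cont := by
    change Continuous fun Y : (Σ _ : Fin N, Fin n) → (H →L[ℂ] H) => purificationExpectation Ψ
      (MultilinearMap.mkPiAlgebraFin ℂ N (H →L[ℂ] H) fun r =>
        (∑ σ : Equiv.Perm (Fin n), w σ • (MultilinearMap.mkPiAlgebraFin ℂ n (H →L[ℂ] H)).domDomCongr
          σ) fun k => Y ⟨r, k⟩)
    refine (purificationExpectation Ψ).continuous.comp
      ((ContinuousMultilinearMap.mkPiAlgebraFin ℂ N (H →L[ℂ] H)).cont.comp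
        (continuous_pi fun r => ?_))
    simp only [sum_apply, smul_apply,
      MultilinearMap.domDomCongr_apply]
    refine continuous_finsetSum _ fun σ _ => Continuous.fun_const_smul ?_ _
    exact (ContinuousMultilinearMap.mkPiAlgebraFin ℂ n (H →L[ℂ] H)).cont.comp
      (continuous_pi fun k => continuous_apply _)

theorem orderingForm_apply (Ψ : HilbertTensorDual H) (N : ℕ) (w : Equiv.Perm (Fin n) → ℂ)
    (Y : Fin n → H →L[ℂ] H) :
    orderingForm Ψ N w (fun p => Y p.2) =
      inner ℂ Ψ (ampliation ((∑ σ, w σ • (List.ofFn fun j => Y (σ j)).prod) ^ N) Ψ) := by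
  change purificationExpectation Ψ
      (MultilinearMap.mkPiAlgebraFin ℂ N (H →L[ℂ] H) fun r =>
        (∑ σ : Equiv.Perm (Fin n), w σ • (MultilinearMap.mkPiAlgebraFin ℂ n (H →L[ℂ] H)).domDomCongr
          σ) Y) = _
  simp only [sum_apply, smul_apply,
      MultilinearMap.domDomCongr_apply, MultilinearMap.mkPiAlgebraFin_apply, List.ofFn_const,
      List.prod_replicate, purificationExpectation_apply]

theorem qcf_eq_orderingForm (A : Fin n → H →L[ℂ] H) (N : ℕ) (w : Equiv.Perm (Fin n) → ℂ)
    (Ψ : HilbertTensorDual H) (θ : EuclideanSpace ℝ (Fin n)) :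
    qcf A N w Ψ θ = orderingForm Ψ N w fun p =>
      NormedSpace.exp ((Complex.I * (θ p.2 : ℂ) / (N : ℂ)) • A p.2) :=
  (orderingForm_apply Ψ N w fun j =>
    NormedSpace.exp ((Complex.I * (θ j : ℂ) / (N : ℂ)) • A j)).symm

theorem norm_exp_I_smul_le {X : H →L[ℂ] H} (hX : IsSelfAdjoint X) (t : ℝ) :
    ‖NormedSpace.exp ((Complex.I * (t : ℂ)) • X)‖ ≤ 1 := by
  have h : NormedSpace.exp ((Complex.I * (t : ℂ)) • X) ∈ unitary (H →L[ℂ] H) := by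
    let _ := NormedAlgebra.restrictScalars ℚ ℂ (H →L[ℂ] H)
    refine NormedSpace.exp_mem_unitary_of_mem_skewAdjoint ?_
    rw [skewAdjoint.mem_iff, star_smul, hX.star_eq]
    simp
  -- On the zero space the identity has norm 0, so only the inequality holds in general.
  rcases subsingleton_or_nontrivial (H →L[ℂ] H) with hs | hs
  · rw [Subsingleton.elim (NormedSpace.exp _ : H →L[ℂ] H) 0, norm_zero]
    exact zero_le_one
  · exact (CStarRing.norm_of_mem_unitary h).le

/-- The N factors of the power occupy separate slots, and B_j is the average over r of the elements
b_{r,j}. A character may take a different value on each b_{r,j}, all in the real spectrum of A_j,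
whence the averages of N spectral points. -/
theorem exists_jointExp_eq_qcf (A : Fin n → H →L[ℂ] H) (hA : ∀ j, IsSelfAdjoint (A j))
    (N : ℕ) (w : Equiv.Perm (Fin n) → ℂ) (Ψ : HilbertTensorDual H) :
    ∃ (𝔄 : Type u) (_ : NormedCommRing 𝔄) (_ : NormedAlgebra ℂ 𝔄) (_ : CompleteSpace 𝔄)
      (B : Fin n → 𝔄) (l : 𝔄 →L[ℂ] ℂ), (∀ θ, ‖jointExp B θ‖ ≤ 1) ∧
      JointSpectrumSubset B {x | ∀ j, x j ∈ averages N (spectrum ℝ (A j))} ∧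
      ∀ θ, qcf A N w Ψ θ = l (jointExp B θ) := by
  obtain ⟨𝔄, i1, i2, i3, b, l, hspec, hl⟩ := exists_commutative_model (orderingForm Ψ N w)
    fun p => A p.2
  have hsum : ∀ θ : EuclideanSpace ℝ (Fin n),
      jointExp (fun j => ∑ r : Fin N, ((N : ℂ)⁻¹) • b ⟨r, j⟩) θ =
        NormedSpace.exp (∑ p : (Σ _ : Fin N, Fin n),
          (Complex.I * (θ p.2 : ℂ) / (N : ℂ)) • b p) := by
    intro θ
    rw [jointExp, Fintype.sum_sigma, Finset.sum_comm]
    congr 1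
    refine Finset.sum_congr rfl fun j _ => ?_
    rw [Finset.smul_sum]
    exact Finset.sum_congr rfl fun r _ => by rw [smul_smul, div_eq_mul_inv]
  refine ⟨𝔄, i1, i2, i3, fun j => ∑ r : Fin N, ((N : ℂ)⁻¹) • b ⟨r, j⟩, l, fun θ => ?_, fun χ => ?_,
    fun θ => ?_⟩
  · rw [hsum]
    refine (hl _).1.trans (Finset.prod_le_one (fun _ _ => norm_nonneg _) fun p _ => ?_)
    have := norm_exp_I_smul_le (hA p.2) (θ p.2 / N)
    push_cast at this
    rwa [← mul_div_assoc] at this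
  · have hreal : ∀ p : (Σ _ : Fin N, Fin n), ∃ x ∈ spectrum ℝ (A p.2), χ (b p) = (x : ℂ) := by
      intro p
      have h1 : χ (b p) ∈ spectrum ℂ (A p.2) := by
        refine hspec p ?_
        exact AlgHom.apply_mem_spectrum (WeakDual.CharacterSpace.toAlgHom χ) (b p)
      have h2 := (hA p.2).mem_spectrum_eq_re h1
      refine ⟨(χ (b p)).re, ?_, h2⟩
      rw [← spectrum.algebraMap_mem_iff ℂ]
      exact h2 ▸ h1
    choose x hx hχ using hreal
    refine ⟨WithLp.toLp 2 fun j => (∑ r, x ⟨r, j⟩) / N, fun j => ⟨fun r => x ⟨r, j⟩, fun r => hx _,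
      rfl⟩, fun j => ?_⟩
    rw [map_sum]
    simp only [map_smul, hχ]
    push_cast
    rw [← Finset.smul_sum, smul_eq_mul, div_eq_inv_mul]
  · rw [qcf_eq_orderingForm, hsum, (hl _).2]

theorem isCompact_averages (N : ℕ) {S : Set ℝ} (hS : IsCompact S) : IsCompact (averages N S) := by
  have : averages N S = (fun s : Fin N → ℝ => (∑ k, s k) / N) '' (univ.pi fun _ => S) := by
    ext y
    simp [averages, eq_comm]
  rw [this]
  exact (isCompact_univ_pi fun _ => hS).image (by fun_prop)

theorem isCompact_pi_averages (A : Fin n → H →L[ℂ] H) (N : ℕ) :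
    IsCompact {x : EuclideanSpace ℝ (Fin n) | ∀ j, x j ∈ averages N (spectrum ℝ (A j))} := by
  have h : IsCompact (univ.pi fun j => averages N (spectrum ℝ (A j))) :=
    isCompact_univ_pi fun j => isCompact_averages N (spectrum.isCompact (A j))
  have h' := h.image (PiLp.continuous_toLp 2 fun _ : Fin n => ℝ)
  convert h' using 1
  ext x
  simp only [mem_ofPred_eq, mem_image, mem_univ_pi]
  exact ⟨fun hx => ⟨x.ofLp, hx, rfl⟩, fun ⟨y, hy, e⟩ => e ▸ hy⟩

/-- The squared norm of Ψ is the sum of the eigenvalues. This is the trace of ρ in a Hilbert basis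
extending the eigenvectors, since ρ kills the added vectors. -/
theorem inner_self_of_isCanonicalPurification {ρ : H →L[ℂ] H} (hρ : IsState ρ)
    {Ψ : HilbertTensorDual H} (hΨ : IsCanonicalPurification ρ Ψ) : inner ℂ Ψ Ψ = 1 := by
  classical
  obtain ⟨ι, l, α, hα, hl, hρl, hΨl⟩ := hΨ
  have hkb : ∀ i j, inner ℂ (ketBra (α i) (α i)) (ketBra (α j) (α j)) =
      if j = i then (1 : ℂ) else 0 := by
    intro i j
    rw [ketBra, ketBra, UniformSpace.Completion.inner_coe, TensorProduct.inner_tmul,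
      inner_bra_bra, orthonormal_iff_ite.1 hα, orthonormal_iff_ite.1 hα]
    by_cases h : i = j
    · simp [h]
    · simp [h, Ne.symm h]
  have hkΨ : ∀ i, inner ℂ (ketBra (α i) (α i)) Ψ = (Real.sqrt (l i) : ℂ) := by
    intro i
    have := hΨl.mapL (innerSL ℂ (ketBra (α i) (α i)))
    simp only [innerSL_apply_apply, inner_smul_right, hkb, mul_ite, mul_one, mul_zero] at this
    refine this.unique ((hasSum_ite_eq i ((Real.sqrt (l i) : ℂ))).congr_fun ?_)
    intro j
    by_cases h : j = i <;> simp [h]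
  have hΨΨ : HasSum (fun i => (l i : ℂ)) (inner ℂ Ψ Ψ) := by
    have := hΨl.mapL (innerSL ℂ Ψ)
    simp only [innerSL_apply_apply, inner_smul_right] at this
    refine this.congr_fun fun i => ?_
    rw [← inner_conj_symm, hkΨ, Complex.conj_ofReal, ← Complex.ofReal_mul,
      Real.mul_self_sqrt (hl i)]
  obtain ⟨s, b, hs, hb⟩ := Orthonormal.exists_hilbertBasis_extension hα.toSubtypeRange
  have hs' : ∀ i, α i ∈ s := fun i => hs ⟨i, rfl⟩
  have htr := hρ.trace_eq_one _ b
  refine hΨΨ.unique ?_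
  have hinj : Function.Injective fun i => (⟨α i, hs' i⟩ : s) := fun i j h =>
    hα.linearIndependent.injective (congrArg Subtype.val h)
  rw [← hinj.hasSum_iff] at htr
  · refine htr.congr_fun fun i => ?_
    have h1 : ρ (α i) = (l i : ℂ) • α i := by
      refine (hρl (α i)).unique ((hasSum_ite_eq i ((l i : ℂ) • α i)).congr_fun fun j => ?_)
      rw [orthonormal_iff_ite.1 hα]
      by_cases h : j = i <;> simp [h]
    simp only [Function.comp, hb]
    rw [h1, inner_smul_right, inner_self_eq_norm_sq_to_K, hα.1 i]
    simp
  · intro x hx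
    have h0 : ρ (b x) = 0 := by
      refine (hρl (b x)).unique (hasSum_zero.congr_fun fun i => ?_)
      have : inner ℂ (α i) (b x) = 0 := by
        have hne : (⟨α i, hs' i⟩ : s) ≠ x := fun h => hx ⟨i, h⟩
        have := b.orthonormal.2 hne
        rw [hb] at this ⊢
        exact this
      rw [this, zero_smul, smul_zero]
    rw [h0, inner_zero_right]

theorem qcf_zero {ρ : H →L[ℂ] H} (hρ : IsState ρ) {Ψ : HilbertTensorDual H}
    (hΨ : IsCanonicalPurification ρ Ψ) (A : Fin n → H →L[ℂ] H) (N : ℕ)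
    {w : Equiv.Perm (Fin n) → ℂ} (hw : ∑ σ, w σ = 1) : qcf A N w Ψ 0 = 1 := by
  have : unitaryOrdering A N w 0 = 1 := by
    simp [unitaryOrdering, NormedSpace.exp_zero, ← Finset.sum_smul, hw, List.ofFn_const]
  rw [qcf, this, ampliation_one, inner_self_of_isCanonicalPurification hρ hΨ]

end OrderingForm

/-! ### Finite order and Fourier estimates -/

section Order

/-- In the Leibniz formula the decay of χ absorbs the weight ‖x‖^k, leaving only sup norms of
derivatives of φ. -/
theorem exists_seminorm_schwartzMul_le {E : Type*} [NormedAddCommGroup E] [NormedSpace ℝ E]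
    (k m : ℕ) (χ : 𝓢(E, ℂ)) : ∃ A : ℝ, 0 ≤ A ∧ ∀ φ : 𝓢(E, ℂ),
      SchwartzMap.seminorm ℂ k m (schwartzMul χ φ) ≤
        A * ∑ i ∈ Finset.range (m + 1), SchwartzMap.seminorm ℂ 0 i φ := by
  refine ⟨∑ i ∈ Finset.range (m + 1), (m.choose i : ℝ) * SchwartzMap.seminorm ℂ k i χ,
    Finset.sum_nonneg fun i _ => mul_nonneg (Nat.cast_nonneg _) (apply_nonneg _ _), fun φ => ?_⟩
  refine SchwartzMap.seminorm_le_bound ℂ k m _ (mul_nonneg (Finset.sum_nonneg fun i _ =>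
    mul_nonneg (Nat.cast_nonneg _) (apply_nonneg _ _))
      (Finset.sum_nonneg fun i _ => apply_nonneg _ _)) fun x => ?_
  have h1 : ⇑(schwartzMul χ φ) = fun x => χ x * φ x := funext (schwartzMul_apply χ φ)
  rw [h1, Finset.sum_mul]
  calc ‖x‖ ^ k * ‖iteratedFDeriv ℝ m (fun x => χ x * φ x) x‖
      ≤ ‖x‖ ^ k * ∑ i ∈ Finset.range (m + 1), (m.choose i : ℝ) * ‖iteratedFDeriv ℝ i χ x‖ *
          ‖iteratedFDeriv ℝ (m - i) φ x‖ := by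
        gcongr
        exact norm_iteratedFDeriv_mul_le (χ.smooth m) (φ.smooth m) x le_rfl
    _ = ∑ i ∈ Finset.range (m + 1), (m.choose i : ℝ) * (‖x‖ ^ k * ‖iteratedFDeriv ℝ i χ x‖) *
          ‖iteratedFDeriv ℝ (m - i) φ x‖ := by
        rw [Finset.mul_sum]
        exact Finset.sum_congr rfl fun i _ => by ring
    _ ≤ _ := by
        refine Finset.sum_le_sum fun i _ => ?_
        refine mul_le_mul (mul_le_mul_of_nonneg_left (SchwartzMap.le_seminorm ℂ k i χ x)
          (Nat.cast_nonneg _)) ?_ (norm_nonneg _)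
          (mul_nonneg (Nat.cast_nonneg _) (apply_nonneg _ _))
        refine (SchwartzMap.norm_iteratedFDeriv_le_seminorm ℂ φ (m - i) x).trans ?_
        exact Finset.single_le_sum (f := fun i => SchwartzMap.seminorm ℂ 0 i φ)
          (fun i _ => apply_nonneg _ _) (Finset.mem_range.2 (by omega))

/-- A distribution which is unchanged under multiplication with a Schwartz function has finite
order and is bounded without weights. -/
theorem exists_norm_le_sum_seminorm {E : Type*} [NormedAddCommGroup E] [NormedSpace ℝ E]
    (u : 𝓢'(E, ℂ)) {χ : 𝓢(E, ℂ)} (hχ : ∀ φ, u (schwartzMul χ φ) = u φ) :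
    ∃ (C : ℝ) (M : ℕ), 0 ≤ C ∧ ∀ φ : 𝓢(E, ℂ),
      ‖u φ‖ ≤ C * ∑ i ∈ Finset.range (M + 1), SchwartzMap.seminorm ℂ 0 i φ := by
  let q : Seminorm ℂ 𝓢(E, ℂ) := (normSeminorm ℂ ℂ).comp (u : 𝓢(E, ℂ) →ₗ[ℂ] ℂ)
  have hq : Continuous q := continuous_norm.comp (map_continuous u)
  obtain ⟨s, C, -, hC⟩ := Seminorm.bound_of_continuous (schwartz_withSeminorms ℂ E ℂ) q hq
  choose A hA0 hA using fun p : ℕ × ℕ => exists_seminorm_schwartzMul_le p.1 p.2 χ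
  refine ⟨C * ∑ p ∈ s, A p, s.sup Prod.snd,
    mul_nonneg C.2 (Finset.sum_nonneg fun p _ => hA0 p), fun φ => ?_⟩
  rw [← hχ]
  have h1 : ‖u (schwartzMul χ φ)‖ ≤ C * (s.sup (schwartzSeminormFamily ℂ E ℂ))
      (schwartzMul χ φ) := hC (schwartzMul χ φ)
  refine h1.trans ?_
  rw [mul_assoc, Finset.sum_mul]
  refine mul_le_mul_of_nonneg_left ?_ C.2
  refine ((Seminorm.finset_sup_le_sum _ s) _).trans ?_
  rw [show (∑ p ∈ s, schwartzSeminormFamily ℂ E ℂ p) (schwartzMul χ φ) =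
      ∑ p ∈ s, schwartzSeminormFamily ℂ E ℂ p (schwartzMul χ φ) from
    map_sum (AddMonoidHom.mk' (fun q : Seminorm ℂ 𝓢(E, ℂ) => q (schwartzMul χ φ))
      fun _ _ => rfl) _ _]
  refine Finset.sum_le_sum fun p hp => (hA p φ).trans ?_
  refine mul_le_mul_of_nonneg_left ?_ (hA0 p)
  refine Finset.sum_le_sum_of_subset_of_nonneg ?_ fun i _ _ => apply_nonneg _ _
  refine Finset.range_subset_range.2 (Nat.add_le_add_right ?_ 1)
  exact Finset.le_sup (f := Prod.snd) hp

variable {n : ℕ}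

theorem seminorm_charTransform_le (m : ℕ) (f : 𝓢(EuclideanSpace ℝ (Fin n), ℂ)) :
    SchwartzMap.seminorm ℂ 0 m (charTransform f) ≤ ∫ θ, ‖θ‖ ^ m * ‖f θ‖ := by
  -- With this L the kernel e^{-2πi L(θ, x)} is e^{iθ·x}, and each derivative in x costs a factor of
  -- at most ‖θ‖.
  let L : EuclideanSpace ℝ (Fin n) →L[ℝ] EuclideanSpace ℝ (Fin n) →L[ℝ] ℝ :=
    (-(2 * Real.pi)⁻¹) • innerSL ℝ
  have hL : 2 * Real.pi * ‖L‖ ≤ 1 := by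
    have h1 : ‖L‖ ≤ (2 * Real.pi)⁻¹ * 1 := by
      refine ContinuousLinearMap.opNorm_le_bound₂ L (by positivity) fun x y => ?_
      change ‖-(2 * Real.pi)⁻¹ * inner ℝ x y‖ ≤ _
      rw [norm_mul, norm_neg, Real.norm_of_nonneg (by positivity), mul_one, mul_assoc]
      gcongr
      exact norm_inner_le_norm x y
    calc 2 * Real.pi * ‖L‖ ≤ 2 * Real.pi * ((2 * Real.pi)⁻¹ * 1) := by gcongr
      _ = 1 := by field_simp
  have hf : ⇑(charTransform f) = VectorFourier.fourierIntegral 𝐞 volume L.toLinearMap₁₂ f := by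
    ext x
    rw [charTransform_apply, VectorFourier.fourierIntegral]
    refine integral_congr_ae (Eventually.of_forall fun θ => ?_)
    beta_reduce
    rw [Circle.smul_def, Real.fourierChar_apply, smul_eq_mul]
    congr 2
    have h2 : L.toLinearMap₁₂ θ x = -(2 * Real.pi)⁻¹ * inner ℝ θ x := rfl
    rw [h2]
    have : (Real.pi : ℂ) ≠ 0 := by exact_mod_cast Real.pi_ne_zero
    push_cast
    field_simp
  have hint : ∀ k : ℕ, Integrable fun θ => ‖θ‖ ^ k * ‖f θ‖ := fun k => f.integrable_pow_mul volume k
  refine SchwartzMap.seminorm_le_bound ℂ 0 m _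
    (integral_nonneg fun θ => by positivity) fun x => ?_
  rw [pow_zero, one_mul, hf, VectorFourier.iteratedFDeriv_fourierIntegral (N := ⊤) L
    (fun k _ => hint k) f.continuous.aestronglyMeasurable le_top]
  refine (VectorFourier.norm_fourierIntegral_le_integral_norm _ _ _ _ _).trans ?_
  refine integral_mono_of_nonneg (Eventually.of_forall fun θ => norm_nonneg _) (hint m)
    (Eventually.of_forall fun θ => ?_)
  refine (VectorFourier.norm_fourierPowSMulRight_le L f θ m).trans ?_
  rw [mul_assoc]
  exact mul_le_of_le_one_left (by positivity) (pow_le_one₀ (by positivity) hL)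

end Order

/-! ### Densities of Fourier transforms and uniqueness from pairings with exponentials -/

section Density

variable {n : ℕ}

/-- The weight `(1 + ‖θ‖²)^r` as a complex valued function. -/
def japaneseWeight (r : ℝ) (θ : EuclideanSpace ℝ (Fin n)) : ℂ := (((1 + ‖θ‖ ^ 2) ^ r : ℝ) : ℂ)

theorem norm_japaneseWeight (r : ℝ) (θ : EuclideanSpace ℝ (Fin n)) :
    ‖japaneseWeight r θ‖ = (1 + ‖θ‖ ^ 2) ^ r := by
  rw [japaneseWeight, Complex.norm_real, Real.norm_of_nonneg (by positivity)]

theorem hasTemperateGrowth_japaneseWeight (r : ℝ) :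
    (japaneseWeight r : EuclideanSpace ℝ (Fin n) → ℂ).HasTemperateGrowth := by
  have := Function.hasTemperateGrowth_one_add_norm_sq_rpow (H := EuclideanSpace ℝ (Fin n)) r
  exact Complex.ofRealCLM.hasTemperateGrowth.comp this

theorem japaneseWeight_mul_neg (r : ℝ) (θ : EuclideanSpace ℝ (Fin n)) :
    japaneseWeight (-r) θ * japaneseWeight r θ = 1 := by
  rw [japaneseWeight, japaneseWeight, ← Complex.ofReal_mul, ← Real.rpow_add (by positivity),
    neg_add_cancel, Real.rpow_zero, Complex.ofReal_one]

/-- Peetre's inequality, from 1 + |a + b|² ≤ 2(1 + |a|²)(1 + |b|²). -/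
theorem japaneseWeight_le {r : ℝ} (hr : 0 ≤ r) (θ τ : EuclideanSpace ℝ (Fin n)) :
    ‖japaneseWeight r θ‖ ≤ 2 ^ r * ‖japaneseWeight r τ‖ * ‖japaneseWeight r (θ - τ)‖ := by
  rw [norm_japaneseWeight, norm_japaneseWeight, norm_japaneseWeight,
    ← Real.mul_rpow (by positivity) (by positivity),
    ← Real.mul_rpow (by positivity) (by positivity)]
  refine Real.rpow_le_rpow (by positivity) ?_ hr
  have h1 : ‖θ‖ ≤ ‖τ‖ + ‖θ - τ‖ := norm_le_insert' _ _
  have h2 : ‖θ‖ ^ 2 ≤ (‖τ‖ + ‖θ - τ‖) ^ 2 := by gcongr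
  nlinarith [sq_nonneg (‖τ‖ - ‖θ - τ‖), sq_nonneg (‖τ‖ * ‖θ - τ‖)]

/-- A tempered distribution which is bounded by finitely many weighted `L¹` norms is given by a
function of the form `(1 + ‖θ‖²)^r g` with `g ∈ L²`. -/
theorem exists_density (T : 𝓢(EuclideanSpace ℝ (Fin n), ℂ) →ₗ[ℂ] ℂ) {C : ℝ} (hC : 0 ≤ C) {M : ℕ}
    (h : ∀ f, ‖T f‖ ≤ C * ∑ m ∈ Finset.range (M + 1), ∫ θ, ‖θ‖ ^ m * ‖f θ‖) :
    ∃ (r : ℝ) (g : EuclideanSpace ℝ (Fin n) → ℂ), 0 ≤ r ∧ MemLp g 2 ∧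
      ∀ f, T f = ∫ θ, g θ * (japaneseWeight r θ * f θ) := by
  -- Dividing by the weight must absorb the powers ‖θ‖^m with m ≤ M and still leave (1 +
  -- ‖θ‖²)^{-(n+1)}, whose square is integrable because 4(n + 1) > n.
  set r : ℝ := M + n + 1
  have hr : 0 ≤ r := by positivity
  let W := SchwartzMap.smulLeftCLM ℂ (japaneseWeight (n := n) (-r))
  have hW : ∀ f θ, W f θ = japaneseWeight (-r) θ * f θ := fun f θ =>
    SchwartzMap.smulLeftCLM_apply_apply (hasTemperateGrowth_japaneseWeight _) f θ
  let W' := SchwartzMap.smulLeftCLM ℂ (japaneseWeight (n := n) r)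
  have hW' : ∀ f θ, W' f θ = japaneseWeight r θ * f θ := fun f θ =>
    SchwartzMap.smulLeftCLM_apply_apply (hasTemperateGrowth_japaneseWeight _) f θ
  have hWW : ∀ f, W (W' f) = f := fun f => by
    ext θ
    rw [hW, hW', ← mul_assoc, japaneseWeight_mul_neg, one_mul]
  let T' : 𝓢(EuclideanSpace ℝ (Fin n), ℂ) →ₗ[ℂ] ℂ := T ∘ₗ (W : _ →ₗ[ℂ] _)
  let J : 𝓢(EuclideanSpace ℝ (Fin n), ℂ) →ₗ[ℂ]
      Lp ℂ 2 (volume : Measure (EuclideanSpace ℝ (Fin n))) :=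
    (SchwartzMap.toLpCLM (E := EuclideanSpace ℝ (Fin n)) ℂ ℂ 2 volume).toLinearMap
  have hdense : DenseRange J :=
    SchwartzMap.denseRange_toLpCLM (E := EuclideanSpace ℝ (Fin n)) (F := ℂ) (p := 2)
      ENNReal.ofNat_ne_top
  have hbound : ∃ C', ∀ f, ‖T' f‖ ≤ C' * ‖J f‖ := by
    let b : EuclideanSpace ℝ (Fin n) → ℝ := fun θ => (1 + ‖θ‖ ^ 2) ^ (-(n + 1 : ℝ))
    have hb : MemLp b 2 volume := by
      have hbc : Continuous b := Continuous.rpow_const (by fun_prop) fun θ =>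
        Or.inl (by positivity)
      rw [memLp_two_iff_integrable_sq hbc.aestronglyMeasurable]
      have h1 : (Module.finrank ℝ (EuclideanSpace ℝ (Fin n)) : ℝ) < 4 * (n + 1) := by
        rw [finrank_euclideanSpace_fin]
        linarith [n.cast_nonneg (α := ℝ)]
      refine (integrable_rpow_neg_one_add_norm_sq h1).congr (Eventually.of_forall fun θ => ?_)
      simp only [b]
      rw [← Real.rpow_mul_natCast (by positivity)]
      congr 1
      push_cast
      ring
    refine ⟨C * ((M + 1) * (∫ θ, ‖b θ‖ ^ (2 : ℝ)) ^ (1 / (2 : ℝ))), fun f => ?_⟩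
    have hm : ∀ m ∈ Finset.range (M + 1), ∫ θ, ‖θ‖ ^ m * ‖W f θ‖ ≤
        (∫ θ, ‖b θ‖ ^ (2 : ℝ)) ^ (1 / (2 : ℝ)) * ‖J f‖ := by
      intro m hm
      have hf : MemLp f 2 volume := f.memLp 2 volume
      have h2 : ENNReal.ofReal 2 = 2 := by simp
      calc ∫ θ, ‖θ‖ ^ m * ‖W f θ‖ ≤ ∫ θ, ‖b θ‖ * ‖f θ‖ := by
            refine integral_mono_of_nonneg (Eventually.of_forall fun θ => by positivity)
              (hb.norm.integrable_mul hf.norm) (Eventually.of_forall fun θ => ?_)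
            have h3 : ‖θ‖ ^ m ≤ (1 + ‖θ‖ ^ 2) ^ (M : ℝ) := by
              rw [Real.rpow_natCast]
              calc ‖θ‖ ^ m ≤ (1 + ‖θ‖ ^ 2) ^ m := by
                    gcongr
                    nlinarith [sq_nonneg (‖θ‖ - 1)]
                _ ≤ _ := pow_le_pow_right₀ (by nlinarith [sq_nonneg ‖θ‖])
                    (Nat.lt_succ_iff.1 (Finset.mem_range.1 hm))
            have h4 : ‖b θ‖ = (1 + ‖θ‖ ^ 2) ^ (M : ℝ) * (1 + ‖θ‖ ^ 2) ^ (-r) := by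
              rw [Real.norm_of_nonneg (by positivity), ← Real.rpow_add (by positivity)]
              simp only [b, r]
              congr 1
              ring
            beta_reduce
            rw [hW, norm_mul, norm_japaneseWeight, ← mul_assoc, h4]
            gcongr
        _ ≤ (∫ θ, ‖b θ‖ ^ (2 : ℝ)) ^ (1 / (2 : ℝ)) * (∫ θ, ‖f θ‖ ^ (2 : ℝ)) ^ (1 / (2 : ℝ)) := by
            have := integral_mul_norm_le_Lp_mul_Lq (μ := volume) (f := fun θ => (b θ : ℂ)) (g := f)
              Real.HolderConjugate.two_two (by rw [h2]; exact hb.ofReal) (by rwa [h2])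
            simpa only [Complex.norm_real] using this
        _ = _ := by
            congr 1
            change _ = ‖f.toLp 2 volume‖
            rw [SchwartzMap.norm_toLp' (by simp) (by simp)]
            norm_num
    calc ‖T' f‖ ≤ C * ∑ m ∈ Finset.range (M + 1), ∫ θ, ‖θ‖ ^ m * ‖W f θ‖ := h (W f)
      _ ≤ C * ∑ m ∈ Finset.range (M + 1), (∫ θ, ‖b θ‖ ^ (2 : ℝ)) ^ (1 / (2 : ℝ)) * ‖J f‖ := by
          gcongr with m hm'
          exact hm m hm'
      _ = _ := by
          rw [Finset.sum_const, Finset.card_range, nsmul_eq_mul]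
          push_cast
          ring
  -- The reweighted functional is bounded in the L² norm, so it extends from the dense Schwartz
  -- functions to L², where the Riesz representation supplies the density.
  let l := T'.extendOfNorm J
  have hl : ∀ f, l (J f) = T' f := LinearMap.extendOfNorm_eq hdense hbound
  let G := (InnerProductSpace.toDual ℂ
    (Lp ℂ 2 (volume : Measure (EuclideanSpace ℝ (Fin n))))).symm l
  refine ⟨r, fun θ => conj (G θ), hr, ?_, fun f => ?_⟩
  · exact (Lp.memLp G).star
  · have h1 : T f = T' (W' f) := by
      change T f = T (W (W' f))
      rw [hWW]
    rw [h1, ← hl, ← InnerProductSpace.toDual_symm_apply, L2.inner_def]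
    refine integral_congr_ae ?_
    filter_upwards [SchwartzMap.coeFn_toLp (W' f) 2 volume] with θ hθ
    have h2 : (J (W' f) : EuclideanSpace ℝ (Fin n) → ℂ) θ = W' f θ := hθ
    rw [h2, hW', RCLike.inner_apply]
    ring

/-- Peetre's inequality shifts the weight onto f and η. Then |g||η| ≤ |g|² + |η|² bounds the
θ-integral uniformly in the translation τ, and f supplies integrability in τ. -/
theorem integrable_mul_translate {g : EuclideanSpace ℝ (Fin n) → ℂ} (hg : MemLp g 2)
    {r : ℝ} (hr : 0 ≤ r) (f η : 𝓢(EuclideanSpace ℝ (Fin n), ℂ)) :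
    Integrable (fun p : EuclideanSpace ℝ (Fin n) × EuclideanSpace ℝ (Fin n) =>
      g p.1 * (japaneseWeight r p.1 * (f p.2 * η (p.1 - p.2)))) (volume.prod volume) := by
  let W := SchwartzMap.smulLeftCLM ℂ (japaneseWeight (n := n) r)
  have hW : ∀ f θ, W f θ = japaneseWeight r θ * f θ := fun f θ =>
    SchwartzMap.smulLeftCLM_apply_apply (hasTemperateGrowth_japaneseWeight _) f θ
  have hw : Continuous (japaneseWeight (n := n) r) :=
    (hasTemperateGrowth_japaneseWeight r).1.continuous
  have hg1 : AEStronglyMeasurable (fun p : EuclideanSpace ℝ (Fin n) × EuclideanSpace ℝ (Fin n) =>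
      g p.1) (volume.prod volume) := hg.1.comp_fst
  have hc : ∀ h : 𝓢(EuclideanSpace ℝ (Fin n), ℂ), Continuous
      fun p : EuclideanSpace ℝ (Fin n) × EuclideanSpace ℝ (Fin n) => h (p.1 - p.2) := fun h =>
    h.continuous.comp (continuous_fst.sub continuous_snd)
  have hF : Integrable (fun p : EuclideanSpace ℝ (Fin n) × EuclideanSpace ℝ (Fin n) =>
      ‖g p.1‖ * ‖W η (p.1 - p.2)‖ * ‖W f p.2‖) (volume.prod volume) := by
    have hmeas : AEStronglyMeasurable
        (fun p : EuclideanSpace ℝ (Fin n) × EuclideanSpace ℝ (Fin n) =>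
          ‖g p.1‖ * ‖W η (p.1 - p.2)‖ * ‖W f p.2‖) (volume.prod volume) :=
      (hg1.norm.mul (hc (W η)).norm.aestronglyMeasurable).mul
        ((W f).continuous.comp continuous_snd).norm.aestronglyMeasurable
    have hη : ∀ τ, MemLp (fun θ => W η (θ - τ)) 2 := fun τ =>
      (SchwartzMap.compSubConstCLM ℂ τ (W η)).memLp 2 volume
    have hint : ∀ τ, Integrable fun θ => ‖g θ‖ * ‖W η (θ - τ)‖ := fun τ =>
      hg.norm.integrable_mul (hη τ).norm
    refine (integrable_prod_iff' hmeas).2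
      ⟨Eventually.of_forall fun τ => (hint τ).mul_const ‖W f τ‖, ?_⟩
    refine Integrable.mono' (g := fun τ => ((∫ θ, ‖g θ‖ ^ 2) + ∫ θ, ‖W η θ‖ ^ 2) * ‖W f τ‖)
      ((W f).integrable.norm.const_mul _) hmeas.norm.prod_swap.integral_prod_right'
      (Eventually.of_forall fun τ => ?_)
    rw [Real.norm_of_nonneg (integral_nonneg fun θ => norm_nonneg _)]
    have h1 : ∀ θ, ‖‖g θ‖ * ‖W η (θ - τ)‖ * ‖W f τ‖‖ = ‖g θ‖ * ‖W η (θ - τ)‖ * ‖W f τ‖ :=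
      fun θ => Real.norm_of_nonneg (by positivity)
    simp only [h1]
    rw [integral_mul_const]
    gcongr
    have i1 := (memLp_two_iff_integrable_sq_norm hg.1).1 hg
    have i2 := (memLp_two_iff_integrable_sq_norm (hη τ).1).1 (hη τ)
    rw [← integral_sub_right_eq_self (fun θ => ‖W η θ‖ ^ 2) τ, ← integral_add i1 i2]
    refine integral_mono (hint τ) (i1.add i2) fun θ => ?_
    dsimp only
    nlinarith [sq_nonneg (‖g θ‖ - ‖W η (θ - τ)‖), sq_nonneg ‖g θ‖, sq_nonneg ‖W η (θ - τ)‖]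
  refine Integrable.mono' (hF.const_mul (2 ^ r)) (hg1.mul ((hw.comp continuous_fst).mul
    ((f.continuous.comp continuous_snd).mul (hc η))).aestronglyMeasurable)
    (Eventually.of_forall fun p => ?_)
  rw [norm_mul, norm_mul, norm_mul, hW, hW, norm_mul, norm_mul]
  have := japaneseWeight_le hr p.1 p.2
  calc ‖g p.1‖ * (‖japaneseWeight r p.1‖ * (‖f p.2‖ * ‖η (p.1 - p.2)‖))
      ≤ ‖g p.1‖ * (2 ^ r * ‖japaneseWeight r p.2‖ * ‖japaneseWeight r (p.1 - p.2)‖ *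
        (‖f p.2‖ * ‖η (p.1 - p.2)‖)) := by gcongr
    _ = _ := by ring

/-- A distribution `v = χ v` with vanishing pairings `⟨v, e^{iτ·x}χ⟩` is zero. -/
theorem eq_zero_of_apply_exp_mul_eq_zero (v : 𝓢'(EuclideanSpace ℝ (Fin n), ℂ))
    {χ : 𝓢(EuclideanSpace ℝ (Fin n), ℂ)} (hχ : ∀ φ, v (schwartzMul χ φ) = v φ)
    (h : ∀ (τ : EuclideanSpace ℝ (Fin n)) (ψ : 𝓢(EuclideanSpace ℝ (Fin n), ℂ)),
      (∀ x, ψ x = Complex.exp (Complex.I * (inner ℝ τ x : ℝ)) * χ x) → v ψ = 0) : v = 0 := by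
  obtain ⟨C, M, hC, hv⟩ := exists_norm_le_sum_seminorm v hχ
  let T : 𝓢(EuclideanSpace ℝ (Fin n), ℂ) →ₗ[ℂ] ℂ :=
    (v : 𝓢(EuclideanSpace ℝ (Fin n), ℂ) →ₗ[ℂ] ℂ) ∘ₗ (charTransformEquiv n : _ →ₗ[ℂ] _)
  have hT : ∀ f, T f = v (charTransform f) := fun f => rfl
  obtain ⟨r, g, hr, hg, hTg⟩ := exists_density T hC (M := M) fun f =>
    (hv (charTransform f)).trans (mul_le_mul_of_nonneg_left
      (Finset.sum_le_sum fun m _ => seminorm_charTransform_le m f) hC)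
  set η := (charTransformEquiv n).symm χ with hη
  -- As v is fixed by χ, T f = T(f * η) with η the inverse transform of χ. This is the superposition
  -- ∫ f(τ) T(η(· - τ)) dτ, and the transform of a translate of η is e^{iτ·x}χ. The density of T
  -- serves to justify the exchange of integrals.
  have key : ∀ f, T f = 0 := by
    intro f
    have h1 : T f = T (SchwartzMap.convolution (ContinuousLinearMap.mul ℂ ℂ) η f) := by
      rw [hT, hT, charTransform_convolution, hη, charTransform_symm, hχ]
    have h1' : T (SchwartzMap.convolution (ContinuousLinearMap.mul ℂ ℂ) η f) =
        T (SchwartzMap.convolution (ContinuousLinearMap.mul ℂ ℂ) f η) := by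
      rw [hT, hT, charTransform_convolution, charTransform_convolution]
      congr 1
      ext x
      rw [schwartzMul_apply, schwartzMul_apply, mul_comm]
    rw [h1, h1', hTg]
    calc ∫ θ, g θ * (japaneseWeight r θ *
          SchwartzMap.convolution (ContinuousLinearMap.mul ℂ ℂ) f η θ)
        = ∫ θ, ∫ τ, g θ * (japaneseWeight r θ * (f τ * η (θ - τ))) := by
          congr 1
          ext θ
          rw [SchwartzMap.convolution_apply, convolution_def, ← integral_const_mul,
            ← integral_const_mul]
          rfl
      _ = ∫ τ, ∫ θ, g θ * (japaneseWeight r θ * (f τ * η (θ - τ))) :=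
          integral_integral_swap (integrable_mul_translate hg hr f η)
      _ = ∫ τ, f τ * T (SchwartzMap.compSubConstCLM ℂ τ η) := by
          congr 1
          ext τ
          rw [hTg, ← integral_const_mul]
          congr 1
          ext θ
          rw [SchwartzMap.compSubConstCLM_apply]
          ring
      _ = 0 := by
          rw [← integral_zero (EuclideanSpace ℝ (Fin n)) ℂ]
          congr 1
          ext τ
          rw [hT, h τ, mul_zero]
          intro x
          rw [charTransform_translate, hη, charTransform_symm]
  ext φ
  have := key ((charTransformEquiv n).symm φ)
  rw [hT, charTransform_symm] at this
  exact this

/-- Two compactly supported distributions with the same pairings with exponentials are equal. -/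
theorem eq_of_hasIntegral_exp {u v : 𝓢'(EuclideanSpace ℝ (Fin n), ℂ)} (hu : IsCompactlySupported u)
    (hv : IsCompactlySupported v) {C : EuclideanSpace ℝ (Fin n) → ℂ}
    (hCu : ∀ θ : EuclideanSpace ℝ (Fin n), HasIntegral u
      (fun x => Complex.exp (Complex.I * (inner ℝ θ x : ℝ))) (C θ))
    (hCv : ∀ θ : EuclideanSpace ℝ (Fin n), HasIntegral v
      (fun x => Complex.exp (Complex.I * (inner ℝ θ x : ℝ))) (C θ)) : u = v := by
  obtain ⟨χ, -, -, -, -, hχ⟩ := exists_schwartz_cutoff (hu.union hv) isOpen_univ (subset_univ _)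
  rw [nhdsSet_union, eventually_sup] at hχ
  rw [← sub_eq_zero]
  refine eq_zero_of_apply_exp_mul_eq_zero (χ := χ) _ (fun φ => ?_) fun τ ψ hψ => ?_
  · have h1 : u (schwartzMul χ φ) = u φ := apply_congr_of_eventually_eq u (hχ.1.mono fun x hx => by
      rw [schwartzMul_apply, hx, one_mul])
    have h2 : v (schwartzMul χ φ) = v φ := apply_congr_of_eventually_eq v (hχ.2.mono fun x hx => by
      rw [schwartzMul_apply, hx, one_mul])
    rw [sub_apply, sub_apply, h1, h2]
  · rw [sub_apply, (hCu τ).2 ψ (hχ.1.mono fun x hx => by rw [hψ, hx, mul_one]),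
      (hCv τ).2 ψ (hχ.2.mono fun x hx => by rw [hψ, hx, mul_one]), sub_self]

end Density

/-! ### The distribution attached to the functional calculus -/

section CalculusDistribution

variable {𝔄 : Type*} [NormedCommRing 𝔄] [NormedAlgebra ℂ 𝔄] {n : ℕ}
  {B : Fin n → 𝔄} {M : ℝ} {K : Set (EuclideanSpace ℝ (Fin n))}

theorem norm_smear_le (hM : ∀ θ, ‖jointExp B θ‖ ≤ M) (f : 𝓢(EuclideanSpace ℝ (Fin n), ℂ)) :
    ‖smear B f‖ ≤ M * ‖SchwartzMap.toLpCLM ℂ ℂ 1 volume f‖ := by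
  rw [SchwartzMap.toLpCLM_apply, SchwartzMap.norm_toLp_one, ← integral_const_mul]
  refine norm_integral_le_of_norm_le (f.integrable.norm.const_mul M)
    (Eventually.of_forall fun θ => ?_)
  rw [norm_smul, mul_comm]
  gcongr
  exact hM θ

variable [CompleteSpace 𝔄]

theorem apply_smear (hM : ∀ θ, ‖jointExp B θ‖ ≤ M) (l : 𝔄 →L[ℂ] ℂ)
    (f : 𝓢(EuclideanSpace ℝ (Fin n), ℂ)) : l (smear B f) = ∫ θ, l (jointExp B θ) * f θ := by
  rw [smear, ← l.integral_comp_comm (integrable_smear hM f)]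
  simp only [map_smul, smul_eq_mul, mul_comm]

theorem continuous_jointCalculus (hM : ∀ θ, ‖jointExp B θ‖ ≤ M) : Continuous (jointCalculus B) := by
  have hsub : ∀ f g, smear B (f - g) = smear B f - smear B g := fun f g => by
    rw [sub_eq_add_neg, smear_add hM, ← neg_one_smul ℂ g, smear_smul, neg_one_smul,
      ← sub_eq_add_neg]
  have h : Continuous (smear B) := by
    rw [continuous_iff_continuousAt]
    intro g
    rw [ContinuousAt, tendsto_iff_norm_sub_tendsto_zero]
    have h1 : Tendsto (fun f : 𝓢(EuclideanSpace ℝ (Fin n), ℂ) =>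
        M * ‖SchwartzMap.toLpCLM ℂ ℂ 1 volume (f - g)‖) (𝓝 g) (𝓝 0) := by
      have : Continuous fun f : 𝓢(EuclideanSpace ℝ (Fin n), ℂ) =>
        M * ‖SchwartzMap.toLpCLM ℂ ℂ 1 (volume : Measure (EuclideanSpace ℝ (Fin n))) (f - g)‖ :=
        continuous_const.mul (((SchwartzMap.toLpCLM ℂ ℂ 1 volume).continuous.comp
          (continuous_id.sub continuous_const)).norm)
      have h0 := this.tendsto g
      rwa [sub_self, map_zero, norm_zero, mul_zero] at h0
    refine squeeze_zero (fun _ => norm_nonneg _) (fun f => ?_) h1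
    rw [← hsub]
    exact norm_smear_le hM _
  exact h.comp (charTransformEquiv n).symm.continuous

/-- The tempered distribution `φ ↦ l(φ(B))`. -/
def calculusDistribution (hM : ∀ θ, ‖jointExp B θ‖ ≤ M) (l : 𝔄 →L[ℂ] ℂ) :
    𝓢'(EuclideanSpace ℝ (Fin n), ℂ) :=
  ContinuousLinearMap.toPointwiseConvergenceCLM ℂ (RingHom.id ℂ) _ _
    { toFun := fun φ => l (jointCalculus B φ)
      map_add' := fun φ ψ => by rw [jointCalculus_add hM, map_add]
      map_smul' := fun c φ => by
        rw [jointCalculus, map_smul, smear_smul, map_smul]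
        rfl
      cont := l.continuous.comp (continuous_jointCalculus hM) }

theorem calculusDistribution_apply (hM : ∀ θ, ‖jointExp B θ‖ ≤ M) (l : 𝔄 →L[ℂ] ℂ)
    (φ : 𝓢(EuclideanSpace ℝ (Fin n), ℂ)) :
    calculusDistribution hM l φ = l (jointCalculus B φ) := rfl

theorem isFourierTransform_calculusDistribution (hM : ∀ θ, ‖jointExp B θ‖ ≤ M) (l : 𝔄 →L[ℂ] ℂ) :
    IsFourierTransform (calculusDistribution hM l) fun θ => l (jointExp B θ) := fun f => by
  rw [calculusDistribution_apply, jointCalculus, charTransformEquiv_symm_charTransform,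
    apply_smear hM]

theorem dsupport_calculusDistribution_subset (hM : ∀ θ, ‖jointExp B θ‖ ≤ M)
    (hB : JointSpectrumSubset B K) (hK : IsCompact K) (l : 𝔄 →L[ℂ] ℂ) :
    Distribution.dsupport (calculusDistribution hM l) ⊆ K := by
  refine sInter_subset_of_mem ⟨fun φ hφ => ?_, hK.isClosed⟩
  rw [calculusDistribution_apply, jointCalculus_eq_zero hM hB hK, map_zero]
  rw [eventually_nhdsSet_iff_forall]
  exact fun x hx => notMem_tsupport_iff_eventuallyEq.1 fun h => hφ h hx

end CalculusDistribution

/-! ### Pairings with smooth functions -/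

section Pairing

variable {n : ℕ} {u : 𝓢'(EuclideanSpace ℝ (Fin n), ℂ)} {C : EuclideanSpace ℝ (Fin n) → ℂ}

theorem IsFourierTransform.unique {v : 𝓢'(EuclideanSpace ℝ (Fin n), ℂ)}
    (hu : IsFourierTransform u C) (hv : IsFourierTransform v C) : u = v := by
  ext φ
  rw [← charTransform_symm φ, ← hu, ← hv]

/-- The pairing can be computed with representatives near the larger set K: any representative near
the support agrees there with one of these, and u does not distinguish them. -/
theorem hasIntegral_of_forall_eq_near {K : Set (EuclideanSpace ℝ (Fin n))} (hK : IsCompact K)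
    (hu : Distribution.dsupport u ⊆ K) {g : EuclideanSpace ℝ (Fin n) → ℂ} (hg : ContDiff ℝ ∞ g)
    {c : ℂ} (h : ∀ ψ : 𝓢(EuclideanSpace ℝ (Fin n), ℂ), (∀ᶠ x in 𝓝ˢ K, ψ x = g x) → u ψ = c) :
    HasIntegral u g c := by
  obtain ⟨ψ, hψ⟩ := exists_schwartz_eq_near hK hg
  have hψ' := hψ.filter_mono (nhdsSet_mono hu)
  refine ⟨⟨ψ, hψ'⟩, fun φ hφ => ?_⟩
  rw [← h ψ hψ]
  refine apply_congr_of_eventually_eq u ?_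
  filter_upwards [hφ, hψ'] with x h1 h2
  rw [h1, h2]

theorem contDiff_exp_I_inner (θ : EuclideanSpace ℝ (Fin n)) : ContDiff ℝ ∞
    fun x : EuclideanSpace ℝ (Fin n) => Complex.exp (Complex.I * (inner ℝ θ x : ℝ)) :=
  Complex.contDiff_exp.comp (contDiff_const.mul
    (Complex.ofRealCLM.contDiff.comp (innerSL ℝ θ).contDiff))

end Pairing

/-! ### Reality and conjugation -/

section Reality

/-- The complex conjugate of a Schwartz function. -/
def conjSchwartz {E : Type*} [NormedAddCommGroup E] [NormedSpace ℝ E] (φ : 𝓢(E, ℂ)) : 𝓢(E, ℂ) :=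
  SchwartzMap.postcompCLM (Complex.conjCLE : ℂ →L[ℝ] ℂ) φ

theorem conjSchwartz_apply {E : Type*} [NormedAddCommGroup E] [NormedSpace ℝ E] (φ : 𝓢(E, ℂ))
    (x : E) : conjSchwartz φ x = conj (φ x) := rfl

variable {n : ℕ} {u : 𝓢'(EuclideanSpace ℝ (Fin n), ℂ)} {C : EuclideanSpace ℝ (Fin n) → ℂ}

/-- The real-valued functions φ + φ̄ and i(φ - φ̄) recover both parts of φ. -/
theorem isRealDistribution_iff_apply_conjSchwartz :
    IsRealDistribution u ↔ ∀ φ, u (conjSchwartz φ) = conj (u φ) := by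
  constructor
  · intro h φ
    have h1 := h (φ + conjSchwartz φ) fun x => by
      rw [add_apply, conjSchwartz_apply]
      simp
    have h2 := h (Complex.I • (φ - conjSchwartz φ)) fun x => by
      rw [smul_apply, sub_apply, conjSchwartz_apply]
      simp
    rw [map_add] at h1
    rw [map_smul, map_sub] at h2
    simp only [Complex.add_im, smul_eq_mul, Complex.mul_im, Complex.I_re, Complex.I_im,
      Complex.sub_re, zero_mul, one_mul, zero_add] at h1 h2
    apply Complex.ext
    · rw [Complex.conj_re]
      linarith
    · rw [Complex.conj_im]
      linarith
  · intro h φ hφ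
    have h1 : conjSchwartz φ = φ := by
      ext x
      rw [conjSchwartz_apply, Complex.conj_eq_iff_im.2 (hφ x)]
    have h2 := h φ
    rw [h1] at h2
    exact Complex.conj_eq_iff_im.1 h2.symm

theorem conjSchwartz_charTransform (f : 𝓢(EuclideanSpace ℝ (Fin n), ℂ)) :
    conjSchwartz (charTransform f) = charTransform (SchwartzMap.compCLMOfContinuousLinearEquiv ℂ
      (ContinuousLinearEquiv.neg ℝ) (conjSchwartz f)) := by
  ext x
  rw [conjSchwartz_apply, charTransform_apply, charTransform_apply, ← integral_conj,
    ← integral_neg_eq_self]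
  congr 1
  ext θ
  rw [map_mul, ← Complex.exp_conj, map_mul, Complex.conj_I, Complex.conj_ofReal, inner_neg_left]
  push_cast
  rw [neg_mul_neg]
  rfl

/-- The pairings with exponentials give the symmetry of C, since conjugating e^{iθ·x} replaces θ by
-θ. The converse uses the weak identity, since conjugating a transform reflects and conjugates the
function transformed. -/
theorem isRealDistribution_iff (hu : IsFourierTransform u C) (hexp : ∀ θ : EuclideanSpace ℝ (Fin n),
    HasIntegral u (fun x => Complex.exp (Complex.I * (inner ℝ θ x : ℝ))) (C θ)) :
    IsRealDistribution u ↔ ∀ θ, C (-θ) = conj (C θ) := by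
  rw [isRealDistribution_iff_apply_conjSchwartz]
  constructor
  · intro h θ
    obtain ⟨ψ, hψ⟩ := (hexp θ).1
    rw [← (hexp θ).2 ψ hψ, ← h ψ]
    refine ((hexp (-θ)).2 _ (hψ.mono fun x hx => ?_)).symm
    beta_reduce
    rw [conjSchwartz_apply, hx, ← Complex.exp_conj, map_mul, Complex.conj_I, Complex.conj_ofReal,
      inner_neg_left]
    push_cast
    rw [neg_mul, mul_neg]
  · intro h φ
    rw [← charTransform_symm φ, conjSchwartz_charTransform, ← hu, ← hu, ← integral_conj,
      ← integral_neg_eq_self]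
    congr 1
    ext θ
    rw [h, map_mul]
    congr 1
    change conj (((charTransformEquiv n).symm φ) (- -θ)) = _
    rw [neg_neg]

end Reality

/-! ### Finite dimension: trigonometric polynomials -/

section FiniteDimension

universe u

variable {H : Type u} [NormedAddCommGroup H] [InnerProductSpace ℂ H] [CompleteSpace H] {n : ℕ}

theorem exp_apply_of_apply_eq_smul {X : H →L[ℂ] H} {c : ℂ} {v : H} (h : X v = c • v) :
    NormedSpace.exp X v = Complex.exp c • v := by
  let _ := NormedAlgebra.restrictScalars ℚ ℂ (H →L[ℂ] H)
  have h1 := (NormedSpace.exp_series_hasSum_exp' (𝕂 := ℂ) X).mapL (ContinuousLinearMap.apply ℂ H v)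
  have h2 := (NormedSpace.exp_series_hasSum_exp' (𝕂 := ℂ) c).smul_const v
  have hpow : ∀ k : ℕ, (X ^ k) v = c ^ k • v := fun k => by
    induction k with
    | zero => simp
    | succ k ih => rw [pow_succ, mul_apply_eq_comp, h, map_smul, ih, smul_smul, pow_succ,
        mul_comm]
  rw [Complex.exp_eq_exp_ℂ]
  refine h1.unique (h2.congr_fun fun k => ?_)
  rw [ContinuousLinearMap.apply_apply, smul_apply, hpow, smul_assoc]

theorem exists_exp_smul_eq_sum [FiniteDimensional ℂ H] {X : H →L[ℂ] H} (hX : IsSelfAdjoint X) :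
    ∃ (a : Fin (Module.finrank ℂ H) → ℝ) (P : Fin (Module.finrank ℂ H) → H →L[ℂ] H),
      ∀ z : ℂ, NormedSpace.exp (z • X) = ∑ k, Complex.exp (z * a k) • P k := by
  have hsym : (X : H →ₗ[ℂ] H).IsSymmetric := hX.isSymmetric
  let b := hsym.eigenvectorBasis rfl
  refine ⟨hsym.eigenvalues rfl, fun k => (innerSL ℂ (b k)).smulRight (b k), fun z => ?_⟩
  ext v
  conv_lhs => rw [← b.sum_repr' v]
  rw [map_sum, sum_apply]
  refine Finset.sum_congr rfl fun k _ => ?_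
  have h : (z • X) (b k) = (z * hsym.eigenvalues rfl k) • b k := by
    rw [smul_apply, mul_smul]
    congr 1
    exact hsym.apply_eigenvectorBasis rfl k
  rw [map_smul, exp_apply_of_apply_eq_smul h, smul_apply, ContinuousLinearMap.smulRight_apply,
    innerSL_apply_apply, smul_comm]

/-- The spectral theorem makes each slot entry a sum of scalar exponentials times fixed operators;
multilinearity expands the form over all choices of one eigenvector index per slot. -/
theorem exists_qcf_eq_sum [FiniteDimensional ℂ H] (A : Fin n → H →L[ℂ] H)
    (hA : ∀ j, IsSelfAdjoint (A j)) (N : ℕ) (w : Equiv.Perm (Fin n) → ℂ) (Ψ : HilbertTensorDual H) :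
    ∃ (S : Type) (_ : Fintype S) (c : S → ℂ) (x : S → EuclideanSpace ℝ (Fin n)),
      ∀ θ : EuclideanSpace ℝ (Fin n),
        qcf A N w Ψ θ = ∑ s, c s * Complex.exp (Complex.I * (inner ℝ θ (x s) : ℝ)) := by
  choose a P haP using fun j => exists_exp_smul_eq_sum (hA j)
  refine ⟨(Σ _ : Fin N, Fin n) → Fin (Module.finrank ℂ H), inferInstance,
    fun s => orderingForm Ψ N w fun p => P p.2 (s p),
    fun s => WithLp.toLp 2 fun j => ∑ r, a j (s ⟨r, j⟩) / N, fun θ => ?_⟩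
  rw [qcf_eq_orderingForm]
  simp only [haP]
  rw [ContinuousMultilinearMap.map_sum]
  refine Finset.sum_congr rfl fun s _ => ?_
  rw [ContinuousMultilinearMap.map_smul_univ, smul_eq_mul, mul_comm, ← Complex.exp_sum]
  congr 2
  rw [Fintype.sum_sigma, Finset.sum_comm, PiLp.inner_apply]
  push_cast
  rw [Finset.mul_sum]
  refine Finset.sum_congr rfl fun j _ => ?_
  simp only [RCLike.inner_apply, conj_trivial]
  push_cast
  rw [Finset.sum_mul, Finset.mul_sum]
  exact Finset.sum_congr rfl fun r _ => by ring

end FiniteDimension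

/-! ### Signed measures -/

section SignedMeasure

variable {n : ℕ} {u : 𝓢'(EuclideanSpace ℝ (Fin n), ℂ)} {C : EuclideanSpace ℝ (Fin n) → ℂ}

theorem apply_eq_sum_of_isFourierTransform {S : Type*} [Fintype S] (hu : IsFourierTransform u C)
    {c : S → ℂ} {x : S → EuclideanSpace ℝ (Fin n)}
    (hC : ∀ θ, C θ = ∑ s, c s * Complex.exp (Complex.I * (inner ℝ θ (x s) : ℝ)))
    (φ : 𝓢(EuclideanSpace ℝ (Fin n), ℂ)) : u φ = ∑ s, c s * φ (x s) := by
  have h : ∀ f : 𝓢(EuclideanSpace ℝ (Fin n), ℂ), u (charTransform f) =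
      ∑ s, c s * charTransform f (x s) := fun f => by
    have hint : ∀ y : EuclideanSpace ℝ (Fin n),
        Integrable fun θ : EuclideanSpace ℝ (Fin n) =>
          Complex.exp (Complex.I * (inner ℝ θ y : ℝ)) * f θ := fun y => by
      have := integrable_smear (norm_jointExp_complex y) f
      simpa only [jointExp_complex, smul_eq_mul, mul_comm] using this
    rw [← hu]
    simp only [hC, Finset.sum_mul, mul_assoc]
    rw [integral_finsetSum _ fun s _ => (hint (x s)).const_mul _]
    simp only [integral_const_mul, charTransform_apply]
  have := h ((charTransformEquiv n).symm φ)
  rwa [charTransform_symm] at this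

theorem IsSignedMeasureDistribution.isRealDistribution (h : IsSignedMeasureDistribution u) :
    IsRealDistribution u := by
  obtain ⟨s, hs⟩ := h
  intro φ hφ
  have h1 : ∀ x, φ x = ((φ x).re : ℂ) := fun x => by
    apply Complex.ext <;> simp [hφ x]
  rw [hs, integral_congr_ae (Eventually.of_forall h1), integral_congr_ae (Eventually.of_forall h1),
    integral_complex_ofReal, integral_complex_ofReal]
  simp

theorem integrable_schwartz_of_isFiniteMeasure (μ : Measure (EuclideanSpace ℝ (Fin n)))
    [IsFiniteMeasure μ] (φ : 𝓢(EuclideanSpace ℝ (Fin n), ℂ)) : Integrable φ μ :=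
  Integrable.of_bound φ.continuous.aestronglyMeasurable (SchwartzMap.seminorm ℂ 0 0 φ)
    (Eventually.of_forall fun x => SchwartzMap.norm_le_seminorm ℂ φ x)

/-- The pair (μ, ν) need not be the Jordan decomposition (p, q) of μ - ν, but μ + q = ν + p, so both
pairs give the same difference of integrals. -/
theorem isSignedMeasureDistribution_of_eq_integral_sub (μ ν : Measure (EuclideanSpace ℝ (Fin n)))
    [IsFiniteMeasure μ] [IsFiniteMeasure ν] (h : ∀ φ, u φ = ∫ x, φ x ∂μ - ∫ x, φ x ∂ν) :
    IsSignedMeasureDistribution u := by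
  refine ⟨μ.toSignedMeasure - ν.toSignedMeasure, fun φ => ?_⟩
  set s := μ.toSignedMeasure - ν.toSignedMeasure with hs
  set p := s.toJordanDecomposition.posPart
  set q := s.toJordanDecomposition.negPart
  have h1 : p.toSignedMeasure - q.toSignedMeasure = μ.toSignedMeasure - ν.toSignedMeasure :=
    s.toSignedMeasure_toJordanDecomposition
  have h2 : μ + q = ν + p := by
    rw [← Measure.toSignedMeasure_eq_toSignedMeasure_iff, Measure.toSignedMeasure_add,
      Measure.toSignedMeasure_add]
    rw [sub_eq_sub_iff_add_eq_add] at h1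
    rw [← h1, add_comm]
  have h3 := congrArg (fun m => ∫ x, φ x ∂m) h2
  beta_reduce at h3
  have hi := fun (m : Measure (EuclideanSpace ℝ (Fin n))) [IsFiniteMeasure m] =>
    integrable_schwartz_of_isFiniteMeasure m φ
  rw [integral_add_measure (hi μ) (hi q), integral_add_measure (hi ν) (hi p)] at h3
  rw [h, sub_eq_sub_iff_add_eq_add, h3, add_comm]

/-- The points x s may coincide, so reality does not make each c s real; averaging u φ with the
conjugate of u φ̄ replaces c s by its real part. Positive and negative parts then give two finite
measures. -/
theorem isSignedMeasureDistribution_of_eq_sum {S : Type*} [Fintype S] (hu : IsRealDistribution u)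
    {c : S → ℂ} {x : S → EuclideanSpace ℝ (Fin n)} (h : ∀ φ, u φ = ∑ s, c s * φ (x s)) :
    IsSignedMeasureDistribution u := by
  have hre : ∀ φ, u φ = ∑ s, ((c s).re : ℂ) * φ (x s) := fun φ => by
    have h1 := isRealDistribution_iff_apply_conjSchwartz.1 hu (conjSchwartz φ)
    have h2 : conjSchwartz (conjSchwartz φ) = φ := by
      ext y
      simp [conjSchwartz_apply]
    rw [h2, h (conjSchwartz φ), map_sum] at h1
    have h3 : u φ = (u φ + u φ) / 2 := by ring
    rw [h3]
    nth_rewrite 1 [h1]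
    rw [h φ, ← Finset.sum_add_distrib, Finset.sum_div]
    refine Finset.sum_congr rfl fun s _ => ?_
    rw [map_mul, conjSchwartz_apply, Complex.conj_conj, ← add_mul, add_comm, Complex.add_conj]
    push_cast
    ring
  have hint : ∀ (a : S → ℝ) (φ : 𝓢(EuclideanSpace ℝ (Fin n), ℂ)), (∀ s, 0 ≤ a s) →
      ∫ y, φ y ∂(∑ s, ENNReal.ofReal (a s) • Measure.dirac (x s)) = ∑ s, (a s : ℂ) * φ (x s) := by
    intro a φ ha
    rw [integral_finsetSum_measure fun s _ => ?_]
    · refine Finset.sum_congr rfl fun s _ => ?_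
      rw [integral_smul_measure, integral_dirac, ENNReal.toReal_ofReal (ha s), Complex.real_smul]
    · exact (integrable_schwartz_of_isFiniteMeasure _ φ).smul_measure ENNReal.ofReal_ne_top
  have hfin : ∀ a : S → ℝ, IsFiniteMeasure
      (∑ s, ENNReal.ofReal (a s) • Measure.dirac (x s)) := fun a => by
    constructor
    simp [Measure.finsetSum_apply, ENNReal.sum_lt_top]
  have := hfin fun s => max (c s).re 0
  have := hfin fun s => max (-(c s).re) 0
  refine isSignedMeasureDistribution_of_eq_integral_sub
    (∑ s, ENNReal.ofReal (max (c s).re 0) • Measure.dirac (x s))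
    (∑ s, ENNReal.ofReal (max (-(c s).re) 0) • Measure.dirac (x s)) fun φ => ?_
  rw [hint (fun s => max (c s).re 0) φ fun s => le_max_right _ _,
    hint (fun s => max (-(c s).re) 0) φ fun s => le_max_right _ _, hre, ← Finset.sum_sub_distrib]
  refine Finset.sum_congr rfl fun s _ => ?_
  rw [← sub_mul, ← Complex.ofReal_sub, max_zero_sub_max_neg_zero_eq_self]

end SignedMeasure

/-! ### Riesz–Markov for functionals bounded by the supremum norm -/

section Riesz

/-- A linear functional on a space of continuous functions on a compact space which is normalized
and bounded by the supremum norm is given by a probability measure. -/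
theorem exists_isProbabilityMeasure_of_le_norm {V X : Type*} [AddCommGroup V] [Module ℝ V]
    [TopologicalSpace X] [CompactSpace X] [T2Space X] [MeasurableSpace X] [BorelSpace X]
    (J : V →ₗ[ℝ] C(X, ℝ)) (F : V →ₗ[ℝ] ℝ) (hF : ∀ v, F v ≤ ‖J v‖) {e : V} (he : J e = 1)
    (hFe : F e = 1) :
    ∃ μ : Measure X, IsProbabilityMeasure μ ∧ ∀ v, ∫ x, J v x ∂μ = F v := by
  have hker : LinearMap.ker J ≤ LinearMap.ker F := fun v hv => by
    rw [LinearMap.mem_ker] at hv ⊢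
    have h1 := hF v
    have h2 := hF (-v)
    rw [map_neg, map_neg, norm_neg] at h2
    rw [hv, norm_zero] at h1 h2
    linarith
  let f : Module.Dual ℝ (LinearMap.range J) :=
    ((LinearMap.ker J).liftQ F hker) ∘ₗ J.quotKerEquivRange.symm.toLinearMap
  have hf : ∀ v, f ⟨J v, LinearMap.mem_range_self J v⟩ = F v := fun v => by
    have h1 : J.quotKerEquivRange.symm ⟨J v, LinearMap.mem_range_self J v⟩ =
        (LinearMap.ker J).mkQ v := by
      rw [LinearEquiv.symm_apply_eq]
      rfl
    change (LinearMap.ker J).liftQ F hker (J.quotKerEquivRange.symm _) = _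
    rw [h1]
    rfl
  obtain ⟨g, hg, hgn⟩ := Module.Dual.exists_continuous_extension_of_le_seminorm_real
    (LinearMap.range J) f (p := normSeminorm ℝ C(X, ℝ)) continuous_norm (by
      rintro ⟨_, v, rfl⟩
      rw [hf]
      exact hF v)
  have hgJ : ∀ v, g (J v) = F v := fun v => (hg ⟨J v, LinearMap.mem_range_self J v⟩).trans (hf v)
  -- A functional of norm at most 1 with g 1 = 1 is positive: for k ≥ 0 the function ‖k‖ - k has
  -- norm at most ‖k‖, so ‖k‖ - g k ≤ ‖k‖.
  have hpos : ∀ k : C(X, ℝ), 0 ≤ k → 0 ≤ g k := fun k hk => by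
    have h1 : ‖‖k‖ • (1 : C(X, ℝ)) - k‖ ≤ ‖k‖ := by
      refine (ContinuousMap.norm_le _ (norm_nonneg k)).2 fun x => ?_
      have h2 : k x ≤ ‖k‖ := (le_abs_self _).trans (k.norm_coe_le_norm x)
      have h3 : 0 ≤ k x := hk x
      rw [ContinuousMap.sub_apply, ContinuousMap.smul_apply, ContinuousMap.one_apply, smul_eq_mul,
        mul_one, Real.norm_of_nonneg (by linarith)]
      linarith
    have h2 := (le_abs_self _).trans ((hgn (‖k‖ • (1 : C(X, ℝ)) - k)).trans h1)
    rw [map_sub, map_smul, ← he, hgJ, hFe, smul_eq_mul, mul_one] at h2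
    linarith
  let Λ : CompactlySupportedContinuousMap X ℝ →ₚ[ℝ] ℝ := PositiveLinearMap.mk₀
    { toFun := fun k => g k.toContinuousMap
      map_add' := fun k k' => map_add g k.toContinuousMap k'.toContinuousMap
      map_smul' := fun c k => map_smul g c k.toContinuousMap }
    fun k hk => hpos k.toContinuousMap fun x => hk x
  have hint : ∀ k : C(X, ℝ), ∫ x, k x ∂(RealRMK.rieszMeasure Λ) = g k := fun k =>
    RealRMK.integral_rieszMeasure Λ (CompactlySupportedContinuousMap.continuousMapEquiv k)
  refine ⟨RealRMK.rieszMeasure Λ, ⟨?_⟩, fun v => by rw [hint, hgJ]⟩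
  have h1 := hint 1
  rw [← he, hgJ, hFe, he] at h1
  simp only [ContinuousMap.one_apply, integral_const, smul_eq_mul, mul_one] at h1
  rwa [measureReal_def, ENNReal.toReal_eq_one_iff] at h1

end Riesz

/-! ### From positivity on squares to a probability measure -/

section PositiveFunctional

variable {n : ℕ} {u : 𝓢'(EuclideanSpace ℝ (Fin n), ℂ)} {K : Set (EuclideanSpace ℝ (Fin n))}

/-- Smooth square roots, up to `ε`, of functions which are nonnegative on a compact set. -/
theorem exists_mul_conj_eq_add_near (hK : IsCompact K) {φ : 𝓢(EuclideanSpace ℝ (Fin n), ℂ)}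
    (hφ : ∀ x, (φ x).im = 0) (hpos : ∀ x ∈ K, 0 ≤ (φ x).re) {ε : ℝ} (hε : 0 < ε) :
    ∃ ψ : 𝓢(EuclideanSpace ℝ (Fin n), ℂ), ∀ᶠ x in 𝓝ˢ K, ψ x * conj (ψ x) = φ x + ε := by
  set a : EuclideanSpace ℝ (Fin n) → ℝ := fun x => (φ x).re + ε with ha
  have hac : ContDiff ℝ ∞ a :=
    (Complex.reCLM.contDiff.comp (φ.smooth ⊤)).add contDiff_const
  -- The switch s is 0 where a ≤ ε/4 and 1 where a ≥ ε/2. Thus a s + (1 - s) is positive everywhere,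
  -- has a smooth square root, and equals a near K, where a > ε/2.
  set s : EuclideanSpace ℝ (Fin n) → ℝ := fun x => Real.smoothTransition (4 * a x / ε - 1) with hs
  have hsc : ContDiff ℝ ∞ s := Real.smoothTransition.contDiff.comp
    (((contDiff_const.mul hac).div_const ε).sub contDiff_const)
  have h0 : ∀ x, 0 < a x * s x + (1 - s x) := fun x => by
    have hs0 : 0 ≤ s x := Real.smoothTransition.nonneg _
    have hs1 : s x ≤ 1 := Real.smoothTransition.le_one _
    rcases le_or_gt (4 * a x / ε - 1) 0 with h | h
    · have : s x = 0 := Real.smoothTransition.zero_of_nonpos h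
      rw [this]
      norm_num
    · have h1 : 0 < a x := by
        by_contra hn
        have : 4 * a x / ε ≤ 0 := div_nonpos_of_nonpos_of_nonneg (by linarith) hε.le
        linarith
      rcases hs1.lt_or_eq with h2 | h2
      · have := mul_nonneg h1.le hs0
        linarith
      · rw [h2]
        linarith
  have hr : ContDiff ℝ ∞ fun x => ((Real.sqrt (a x * s x + (1 - s x)) : ℝ) : ℂ) :=
    Complex.ofRealCLM.contDiff.comp
      (((hac.mul hsc).add (contDiff_const.sub hsc)).sqrt fun x => (h0 x).ne')
  obtain ⟨ψ, hψ⟩ := exists_schwartz_eq_near hK hr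
  have hnear : ∀ᶠ x in 𝓝ˢ K, ε / 2 < a x :=
    (isOpen_lt continuous_const hac.continuous).mem_nhdsSet.2 fun x hx => by
      have := hpos x hx
      change ε / 2 < (φ x).re + ε
      linarith
  refine ⟨ψ, ?_⟩
  filter_upwards [hψ, hnear] with x h1 h2
  have h3 : s x = 1 := Real.smoothTransition.one_of_one_le (by
    rw [le_sub_iff_add_le, le_div_iff₀ hε]
    linarith)
  rw [h1, Complex.conj_ofReal, ← Complex.ofReal_mul, Real.mul_self_sqrt (h0 x).le, h3]
  apply Complex.ext <;> simp [ha, hφ x]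

/-- Near K the function φ + ε is of the form |ψ|², and normalization turns the added ε into u φ + ε;
then ε tends to 0. -/
theorem apply_nonneg_of_nonneg_on (hK : IsCompact K) (hu : Distribution.dsupport u ⊆ K)
    (h1 : HasIntegral u (fun _ => 1) 1)
    (hsq : ∀ ψ, 0 ≤ (u (schwartzMul ψ (conjSchwartz ψ))).re ∧
      (u (schwartzMul ψ (conjSchwartz ψ))).im = 0)
    {φ : 𝓢(EuclideanSpace ℝ (Fin n), ℂ)} (hφ : ∀ x, (φ x).im = 0)
    (hpos : ∀ x ∈ K, 0 ≤ (φ x).re) : 0 ≤ (u φ).re ∧ (u φ).im = 0 := by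
  have key : ∀ ε : ℝ, 0 < ε → 0 ≤ (u φ).re + ε ∧ (u φ).im = 0 := fun ε hε => by
    obtain ⟨ψ, hψ⟩ := exists_mul_conj_eq_add_near hK hφ hpos hε
    obtain ⟨χ, hχ⟩ := h1.1
    have h2 : u (schwartzMul ψ (conjSchwartz ψ)) = u φ + ε := by
      have h3 : u (schwartzMul ψ (conjSchwartz ψ)) = u (φ + (ε : ℂ) • χ) := by
        refine apply_congr_of_eventually_eq u ?_
        filter_upwards [hψ.filter_mono (nhdsSet_mono hu), hχ] with x h4 h5
        rw [schwartzMul_apply, conjSchwartz_apply, h4, add_apply, smul_apply, h5, smul_eq_mul,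
          mul_one]
      rw [h3, map_add, map_smul, h1.2 χ hχ, smul_eq_mul, mul_one]
    have h3 := hsq ψ
    rw [h2] at h3
    simpa using h3
  refine ⟨le_of_forall_pos_le_add fun ε hε => (key ε hε).1, (key 1 one_pos).2⟩

theorem isProbabilityDistribution_of_apply_mul_conj_nonneg (hK : IsCompact K)
    (hu : Distribution.dsupport u ⊆ K) (h1 : HasIntegral u (fun _ => 1) 1)
    (hsq : ∀ ψ, 0 ≤ (u (schwartzMul ψ (conjSchwartz ψ))).re ∧
      (u (schwartzMul ψ (conjSchwartz ψ))).im = 0) : IsProbabilityDistribution u := by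
  have := isCompact_iff_compactSpace.1 hK
  let ι : 𝓢(EuclideanSpace ℝ (Fin n), ℝ) →ₗ[ℝ] 𝓢(EuclideanSpace ℝ (Fin n), ℂ) :=
    (SchwartzMap.postcompCLM Complex.ofRealCLM).toLinearMap
  have hι : ∀ φ x, ι φ x = (φ x : ℂ) := fun φ x => rfl
  let J : 𝓢(EuclideanSpace ℝ (Fin n), ℝ) →ₗ[ℝ] C(K, ℝ) :=
    { toFun := fun φ => ⟨fun x => φ x, φ.continuous.comp continuous_subtype_val⟩
      map_add' := fun _ _ => rfl
      map_smul' := fun _ _ => rfl }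
  let F : 𝓢(EuclideanSpace ℝ (Fin n), ℝ) →ₗ[ℝ] ℝ :=
    { toFun := fun φ => (u (ι φ)).re
      map_add' := fun φ ψ => by rw [map_add, map_add, Complex.add_re]
      map_smul' := fun c φ => by
        have h2 : ι (c • φ) = (c : ℂ) • ι φ := by
          ext x
          rw [hι, smul_apply, smul_apply, hι, smul_eq_mul, smul_eq_mul, Complex.ofReal_mul]
        rw [h2, map_smul, smul_eq_mul, Complex.re_ofReal_mul]
        rfl }
  obtain ⟨χ, hχc, hχs, -, -, -, hχ1⟩ := exists_contDiff_cutoff hK isOpen_univ (subset_univ K)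
  let e : 𝓢(EuclideanSpace ℝ (Fin n), ℝ) := hχs.toSchwartzMap hχc
  have he : ∀ x ∈ K, e x = 1 := fun x hx =>
    (eventually_nhdsSet_iff_forall.1 hχ1 x hx).self_of_nhds
  have hue : u (ι e) = 1 := h1.2 _ ((hχ1.filter_mono (nhdsSet_mono hu)).mono fun x hx => by
    rw [hι]
    change ((χ x : ℝ) : ℂ) = 1
    rw [hx, Complex.ofReal_one])
  -- Positivity is applied to ‖φ‖_K e - φ, which is nonnegative on K because e = 1 there.
  have hkey : ∀ φ : 𝓢(EuclideanSpace ℝ (Fin n), ℝ), F φ ≤ ‖J φ‖ ∧ (u (ι φ)).im = 0 := fun φ => by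
    have h2 : u (ι (‖J φ‖ • e - φ)) = ‖J φ‖ - u (ι φ) := by
      have : ι (‖J φ‖ • e - φ) = (‖J φ‖ : ℂ) • ι e - ι φ := by
        ext x
        simp [hι]
      rw [this, map_sub, map_smul, hue, smul_eq_mul, mul_one]
    have h3 := apply_nonneg_of_nonneg_on hK hu h1 hsq (φ := ι (‖J φ‖ • e - φ))
      (fun x => by rw [hι, Complex.ofReal_im]) fun x hx => by
        rw [hι, Complex.ofReal_re, sub_apply, smul_apply, he x hx, smul_eq_mul, mul_one, sub_nonneg]
        exact (le_abs_self _).trans ((J φ).norm_coe_le_norm ⟨x, hx⟩)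
    rw [h2] at h3
    simpa [F] using h3
  obtain ⟨μ, hμ, hμF⟩ := exists_isProbabilityMeasure_of_le_norm J F (fun φ => (hkey φ).1) (e := e)
    (by ext x; exact he x x.2) (by change (u (ι e)).re = 1; rw [hue, Complex.one_re])
  have hv : Measurable (Subtype.val : K → EuclideanSpace ℝ (Fin n)) := measurable_subtype_coe
  have := Measure.isProbabilityMeasure_map (μ := μ) hv.aemeasurable
  refine ⟨μ.map Subtype.val, this, fun φ => ?_⟩
  have hreal : ∀ ψ : 𝓢(EuclideanSpace ℝ (Fin n), ℝ),
      u (ι ψ) = ((∫ x, ψ x ∂(μ.map Subtype.val) : ℝ) : ℂ) := fun ψ => by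
    rw [integral_map hv.aemeasurable ψ.continuous.aestronglyMeasurable]
    have h2 : ∫ x : K, ψ x ∂μ = F ψ := hμF ψ
    rw [h2]
    apply Complex.ext
    · rfl
    · rw [(hkey ψ).2, Complex.ofReal_im]
  let φr := SchwartzMap.postcompCLM Complex.reCLM φ
  let φi := SchwartzMap.postcompCLM Complex.imCLM φ
  have hdec : φ = ι φr + Complex.I • ι φi := by
    ext x
    rw [add_apply, smul_apply, hι, hι, smul_eq_mul, mul_comm]
    exact (Complex.re_add_im (φ x)).symm
  have hint := integrable_schwartz_of_isFiniteMeasure (μ.map Subtype.val) φ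
  rw [← integral_re_add_im hint]
  conv_lhs => rw [hdec]
  rw [map_add, map_smul, hreal, hreal, smul_eq_mul, mul_comm]
  rfl

end PositiveFunctional

/-! ### Positive definiteness -/

section BochnerCondition

variable {n : ℕ}

/-- The double sum is the integral of χ |∑ c_j e^{i t_j·x}|². Keeping the nonnegative cutoff χ
avoids having to show that μ is carried by the support. -/
theorem isPositiveDefiniteFunction_of_isProbabilityDistribution
    {u : 𝓢'(EuclideanSpace ℝ (Fin n), ℂ)} {C : EuclideanSpace ℝ (Fin n) → ℂ}
    (hu : IsCompactlySupported u) (hexp : ∀ θ : EuclideanSpace ℝ (Fin n), HasIntegral u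
      (fun x => Complex.exp (Complex.I * (inner ℝ θ x : ℝ))) (C θ))
    (h : IsProbabilityDistribution u) : IsPositiveDefiniteFunction C := by
  obtain ⟨μ, hμ, hμu⟩ := h
  intro m t c
  obtain ⟨χ, hχc, hχs, -, hχ0, -, hχ1⟩ := exists_contDiff_cutoff hu isOpen_univ (subset_univ _)
  let ψ : EuclideanSpace ℝ (Fin n) → 𝓢(EuclideanSpace ℝ (Fin n), ℂ) := fun θ =>
    ((hχs.comp_left (g := Complex.ofReal) Complex.ofReal_zero).mul_right
      (f' := fun x => Complex.exp (Complex.I * (inner ℝ θ x : ℝ)))).toSchwartzMap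
      ((Complex.ofRealCLM.contDiff.comp hχc).mul (contDiff_exp_I_inner θ))
  have hψ : ∀ θ x, ψ θ x = (χ x : ℂ) * Complex.exp (Complex.I * (inner ℝ θ x : ℝ)) :=
    fun θ x => rfl
  have hC : ∀ θ, C θ = ∫ x, ψ θ x ∂μ := fun θ => by
    rw [← hμu]
    refine ((hexp θ).2 _ (hχ1.mono fun x hx => ?_)).symm
    rw [hψ, hx, Complex.ofReal_one, one_mul]
  have hint : ∀ θ, Integrable (ψ θ) μ := fun θ => integrable_schwartz_of_isFiniteMeasure μ _
  have hsum : ∑ j, ∑ k, c j * conj (c k) * C (t j - t k) = ((∫ x, χ x *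
      Complex.normSq (∑ j, c j * Complex.exp (Complex.I * (inner ℝ (t j) x : ℝ))) ∂μ : ℝ) : ℂ) := by
    rw [← integral_complex_ofReal]
    simp only [hC, ← integral_const_mul]
    calc ∑ j, ∑ k, ∫ x, c j * conj (c k) * ψ (t j - t k) x ∂μ
        = ∫ x, ∑ j, ∑ k, c j * conj (c k) * ψ (t j - t k) x ∂μ := by
          rw [integral_finsetSum _ fun j _ => integrable_finsetSum _ fun k _ =>
            (hint _).const_mul _]
          exact Finset.sum_congr rfl fun j _ =>
            (integral_finsetSum _ fun k _ => (hint _).const_mul _).symm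
      _ = _ := by
          congr 1
          ext x
          rw [Complex.ofReal_mul, Complex.normSq_eq_conj_mul_self, mul_comm (conj _), map_sum,
            Finset.sum_mul_sum, Finset.mul_sum]
          refine Finset.sum_congr rfl fun j _ => ?_
          rw [Finset.mul_sum]
          refine Finset.sum_congr rfl fun k _ => ?_
          have h1 : Complex.exp (Complex.I * (inner ℝ (t j - t k) x : ℝ)) =
              Complex.exp (Complex.I * (inner ℝ (t j) x : ℝ)) *
                Complex.exp (-Complex.I * (inner ℝ (t k) x : ℝ)) := by
            rw [← Complex.exp_add, inner_sub_left]
            push_cast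
            ring_nf
          rw [hψ, map_mul, ← Complex.exp_conj, map_mul, Complex.conj_I, Complex.conj_ofReal, h1]
          ring
  rw [hsum]
  exact ⟨integral_nonneg fun x => mul_nonneg (hχ0 x) (Complex.normSq_nonneg _), Complex.ofReal_im _⟩

/-- The integral of a function with values in a set lies in the closed real span of the set. -/
theorem integral_mem_closure_span {α E : Type*} [MeasurableSpace α] {μ : Measure α}
    [NormedAddCommGroup E] [NormedSpace ℝ E] [CompleteSpace E] {S : Set E} {F : α → E}
    (hF : Integrable F μ) (hS : ∀ x, F x ∈ S) :
    ∫ x, F x ∂μ ∈ closure (Submodule.span ℝ S : Set E) := by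
  by_contra hn
  obtain ⟨f, c, hf, hc⟩ := geometric_hahn_banach_closed_point
    (Submodule.span ℝ S).convex.closure isClosed_closure hn
  have hc0 : 0 < c := by
    have := hf 0 (subset_closure (zero_mem _))
    rwa [map_zero] at this
  -- A functional that stays below c on a subspace vanishes on it: otherwise rescaling an element
  -- would give it the value c.
  have h0 : ∀ x, f (F x) = 0 := fun x => by
    by_contra hne
    have := hf ((c / f (F x)) • F x)
      (subset_closure (Submodule.smul_mem _ _ (Submodule.subset_span (hS x))))
    rw [map_smul, smul_eq_mul, div_mul_cancel₀ _ hne] at this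
    exact this.false
  rw [← f.integral_comp_comm hF] at hc
  simp only [h0, integral_zero] at hc
  exact hc.not_gt hc0

variable {𝔄 : Type*} [NormedCommRing 𝔄] [NormedAlgebra ℂ 𝔄] [CompleteSpace 𝔄]
  {B : Fin n → 𝔄} {M : ℝ}

/-- Positive definiteness says exactly that l(z₁z₂) ≥ 0 on the real span of the pairs (c e^{iθ·B},
c̄ e^{-iθ·B}). The pair of smeared elements is an integral of such pairs, so it lies in the closure
of the span, and the condition is closed. -/
theorem apply_smear_mul_smear_nonneg (hM : ∀ θ, ‖jointExp B θ‖ ≤ M) (l : 𝔄 →L[ℂ] ℂ)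
    (hl : IsPositiveDefiniteFunction fun θ => l (jointExp B θ))
    {f g : 𝓢(EuclideanSpace ℝ (Fin n), ℂ)} (hg : ∀ θ, g (-θ) = conj (f θ)) :
    0 ≤ (l (smear B f * smear B g)).re ∧ (l (smear B f * smear B g)).im = 0 := by
  let G : ℂ × EuclideanSpace ℝ (Fin n) → 𝔄 × 𝔄 := fun p =>
    (p.1 • jointExp B p.2, conj p.1 • jointExp B (-p.2))
  have hspan : ∀ z ∈ Submodule.span ℝ (range G),
      0 ≤ (l (z.1 * z.2)).re ∧ (l (z.1 * z.2)).im = 0 := by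
    intro z hz
    obtain ⟨m, r, p, rfl⟩ := Submodule.mem_span_set'.1 hz
    choose q hq using fun i => (p i).2
    have h1 : l ((∑ i, r i • (p i : 𝔄 × 𝔄)).1 * (∑ i, r i • (p i : 𝔄 × 𝔄)).2) =
        ∑ j, ∑ k, (r j * (q j).1) * conj (r k * (q k).1) *
          l (jointExp B ((q j).2 - (q k).2)) := by
      rw [Prod.fst_sum, Prod.snd_sum, Finset.sum_mul_sum, map_sum]
      refine Finset.sum_congr rfl fun j _ => ?_
      rw [map_sum]
      refine Finset.sum_congr rfl fun k _ => ?_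
      rw [← hq j, ← hq k, sub_eq_add_neg, jointExp_add]
      simp only [G, Prod.smul_mk]
      rw [smul_mul_smul_comm, smul_mul_smul_comm, ← Complex.coe_smul, map_smul, map_smul,
        smul_eq_mul, smul_eq_mul, map_mul (starRingEnd ℂ), Complex.conj_ofReal]
      push_cast
      ring
    rw [h1]
    exact hl m (fun j => (q j).2) fun j => r j * (q j).1
  have hclosed : IsClosed {z : 𝔄 × 𝔄 | 0 ≤ (l (z.1 * z.2)).re ∧ (l (z.1 * z.2)).im = 0} := by
    have hc : Continuous fun z : 𝔄 × 𝔄 => l (z.1 * z.2) :=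
      l.continuous.comp (continuous_fst.mul continuous_snd)
    exact (isClosed_le continuous_const (Complex.continuous_re.comp hc)).inter
      (isClosed_eq (Complex.continuous_im.comp hc) continuous_const)
  have hf := integrable_smear hM f
  have hg' : Integrable fun θ => conj (f θ) • jointExp B (-θ) := by
    have := (integrable_smear hM g).comp_neg
    simpa only [hg] using this
  have hmem := integral_mem_closure_span (S := range G) (hf.prodMk hg') fun θ => ⟨(f θ, θ), rfl⟩
  rw [integral_pair hf hg'] at hmem
  have hgs : ∫ θ, conj (f θ) • jointExp B (-θ) = smear B g := by
    rw [smear, ← integral_neg_eq_self (fun θ => g θ • jointExp B θ)]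
    simp only [hg]
  rw [hgs] at hmem
  exact closure_minimal hspan hclosed hmem

/-- By multiplicativity |φ|² becomes a product of smeared elements, and the inverse transform of φ̄
is the reflected conjugate of that of φ. -/
theorem calculusDistribution_mul_conj_nonneg (hM : ∀ θ, ‖jointExp B θ‖ ≤ M) (l : 𝔄 →L[ℂ] ℂ)
    (hl : IsPositiveDefiniteFunction fun θ => l (jointExp B θ))
    (φ : 𝓢(EuclideanSpace ℝ (Fin n), ℂ)) :
    0 ≤ (calculusDistribution hM l (schwartzMul φ (conjSchwartz φ))).re ∧
      (calculusDistribution hM l (schwartzMul φ (conjSchwartz φ))).im = 0 := by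
  rw [calculusDistribution_apply, jointCalculus_mul hM]
  refine apply_smear_mul_smear_nonneg hM l hl fun θ => ?_
  nth_rewrite 1 [← charTransform_symm φ]
  rw [conjSchwartz_charTransform, charTransformEquiv_symm_charTransform]
  change conj (((charTransformEquiv n).symm φ) (- -θ)) = _
  rw [neg_neg]

end BochnerCondition

end

theorem theorem1 {H : Type*} [NormedAddCommGroup H] [InnerProductSpace ℂ H] [CompleteSpace H]
    (ρ : H →L[ℂ] H) (hρ : IsState ρ)
    (Ψ : HilbertTensorDual H) (hΨ : IsCanonicalPurification ρ Ψ)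
    (n : ℕ) (A : Fin n → H →L[ℂ] H) (hA : ∀ j, IsSelfAdjoint (A j))
    (N : ℕ) (hN : 0 < N) (w : Equiv.Perm (Fin n) → ℂ) (hw : ∑ σ, w σ = 1) :
    ContDiff ℝ ∞ (qcf A N w Ψ) ∧ (∃ M : ℝ, ∀ θ, ‖qcf A N w Ψ θ‖ ≤ M) ∧
    ∃ Pr : 𝓢'(EuclideanSpace ℝ (Fin n), ℂ),
      -- existence, in `ℰ'(ℝⁿ)`
      IsCompactlySupported Pr ∧ IsFourierTransform Pr (qcf A N w Ψ) ∧
      (∀ θ : EuclideanSpace ℝ (Fin n), HasIntegral Pr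
        (fun x => Complex.exp (Complex.I * (inner ℝ θ x : ℝ))) (qcf A N w Ψ θ)) ∧
      -- uniqueness, for both readings of the Fourier transform
      (∀ u : 𝓢'(EuclideanSpace ℝ (Fin n), ℂ), IsFourierTransform u (qcf A N w Ψ) → u = Pr) ∧
      (∀ u : 𝓢'(EuclideanSpace ℝ (Fin n), ℂ), IsCompactlySupported u →
        (∀ θ : EuclideanSpace ℝ (Fin n), HasIntegral u
          (fun x => Complex.exp (Complex.I * (inner ℝ θ x : ℝ))) (qcf A N w Ψ θ)) → u = Pr) ∧
      -- localization of the support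
      Distribution.dsupport Pr ⊆ {x | ∀ j, x j ∈ averages N (spectrum ℝ (A j))} ∧
      -- normalization
      HasIntegral Pr (fun _ => 1) 1 ∧
      -- moments
      (∀ α : Fin n → ℕ, HasIntegral Pr (fun x => ((∏ j, x j ^ α j : ℝ) : ℂ))
        ((1 / Complex.I ^ (∑ j, α j)) * mixedPartialDeriv α (qcf A N w Ψ) 0)) ∧
      -- reality
      (IsRealDistribution Pr ↔ ∀ θ, qcf A N w Ψ (-θ) = conj (qcf A N w Ψ θ)) ∧
      (FiniteDimensional ℂ H →
        (IsSignedMeasureDistribution Pr ↔ ∀ θ, qcf A N w Ψ (-θ) = conj (qcf A N w Ψ θ))) ∧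
      -- nonnegativity
      (IsProbabilityDistribution Pr ↔ IsPositiveDefiniteFunction (qcf A N w Ψ)) := by
  -- From here on only l, B and the localization of the joint spectrum matter; the operators return
  -- for l 1 = 1 and for the finite-dimensional claim.
  obtain ⟨𝔄, _, _, _, B, l, hM, hB, hl⟩ := exists_jointExp_eq_qcf A hA N w Ψ
  have hC : qcf A N w Ψ = fun θ => l (jointExp B θ) := funext hl
  have h0 : l 1 = 1 := by
    rw [← jointExp_zero B, ← hl, qcf_zero hρ hΨ A N hw]
  have hK := isCompact_pi_averages A N
  have hsupp := dsupport_calculusDistribution_subset hM hB hK l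
  have hcomp : IsCompactlySupported (calculusDistribution hM l) :=
    hK.of_isClosed_subset Distribution.isClosed_dsupport hsupp
  have hF : IsFourierTransform (calculusDistribution hM l) (qcf A N w Ψ) :=
    hC ▸ isFourierTransform_calculusDistribution hM l
  have hexp : ∀ θ : EuclideanSpace ℝ (Fin n), HasIntegral (calculusDistribution hM l)
      (fun x => Complex.exp (Complex.I * (inner ℝ θ x : ℝ))) (qcf A N w Ψ θ) := fun θ =>
    hasIntegral_of_forall_eq_near hK hsupp (contDiff_exp_I_inner θ) fun ψ hψ => by
      rw [calculusDistribution_apply, jointCalculus_eq_jointExp hM hB hK θ hψ, hl]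
  have hone : HasIntegral (calculusDistribution hM l) (fun _ => 1) 1 :=
    hasIntegral_of_forall_eq_near hK hsupp contDiff_const fun ψ hψ => by
      rw [calculusDistribution_apply, jointCalculus_eq_one hM hB hK hψ, h0]
  have hreal := isRealDistribution_iff hF hexp
  refine ⟨?_, ⟨‖l‖, fun θ => ?_⟩, calculusDistribution hM l, hcomp, hF, hexp,
    fun u hu => hu.unique hF, fun u hu hu' => eq_of_hasIntegral_exp hu hcomp hu' hexp, hsupp, hone,
    fun α => ?_, hreal, fun _ => ?_, fun h => ?_, fun h => ?_⟩
  · rw [hC]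
    exact (l.restrictScalars ℝ).contDiff.comp (contDiff_jointExp B)
  · rw [hl]
    exact (l.le_opNorm _).trans (mul_le_of_le_one_right (norm_nonneg _) (hM θ))
  · have hmono : ContDiff ℝ ∞ fun x : EuclideanSpace ℝ (Fin n) => ∏ j, x j ^ α j :=
      contDiff_prod fun j _ => (EuclideanSpace.proj (𝕜 := ℝ) j).contDiff.pow (α j)
    refine hasIntegral_of_forall_eq_near hK hsupp (Complex.ofRealCLM.contDiff.comp hmono)
      fun ψ hψ => ?_
    rw [calculusDistribution_apply, jointCalculus_eq_monomial hM hB hK α hψ, hC,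
      moment_eq_mixedPartialDeriv]
  · rw [← hreal]
    refine ⟨IsSignedMeasureDistribution.isRealDistribution, fun h => ?_⟩
    obtain ⟨S, _, c, x, hS⟩ := exists_qcf_eq_sum A hA N w Ψ
    exact isSignedMeasureDistribution_of_eq_sum h (apply_eq_sum_of_isFourierTransform hF hS)
  · exact isPositiveDefiniteFunction_of_isProbabilityDistribution hcomp hexp h
  · exact isProbabilityDistribution_of_apply_mul_conj_nonneg hK hsupp hone
      (calculusDistribution_mul_conj_nonneg hM l (hC ▸ h))
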